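/- Let $m\ge 2$ and $X_m=\{x_1,\dots,x_m\}$. For $\ell\in\mathbb N$ let $B_\ell$ be the set of cyclically reduced words of length at most $\ell$ in the letters $x_1^{\pm1},\dots,x_m^{\pm1}$. A sequence of random groups $(G_\ell(m,d))$ with $m$ generators at density $d\in\{-\infty\}\cup[0,1]$ is given by $G_\ell(m,d)=\langle X_m\mid R_\ell\rangle$, where $(R_\ell)$ is a sequence of random subsets $R_\ell\subseteq B_\ell$ such that * (permutation invariance) for every $\ell$, the law of $R_\ell$ is invariant under all permutations of the set $B_\ell$; * (density $d$) the random variables $\log_{|B_\ell|}|R_\ell|$ (equal to $-\infty$ when $R_\ell=\emptyset$) converge in probability to the constant $d$ as $\ell\to\infty$. An event depending on $\ell$ holds *asymptotically almost surely* (a.a.s.) if its probability tends to $1$ as $\ell\to\infty$. A *piece* with respect to a set $R$ of relators is a word that appears at least twice as a cyclic subword of the relators in $R$ and their inverses: in two different relators, or in the same relator at two different positions or in opposite directions (a cyclic subword of $r$ is a prefix of a cyclic permutation of $r$). The presentation $\langle X_m\mid R\rangle$ satisfies the small cancellation condition $C'(\lambda)$ if every piece $w$ satisfies $|w|\le\lambda|r|$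 for every relator $r\in R$ such that $w$ is a cyclic subword of $r$ or $r^{-1}$. **Proposition.** Let $0<\lambda<1$ and let $(G_\ell(m,d))$ be a sequence of random groups with $m\ge2$ generators at density $d$. 1. If $d<\lambda/2$, then a.a.s. $G_\ell(m,d)$ satisfies $C'(\lambda)$. 2. If $d>\lambda/2$, then a.a.s. $G_\ell(m,d)$ does not satisfy $C'(\lambda)$. -/

import Mathlib

open Filter Topology MeasureTheory

namespace RandomGroup

/-- Words in the alphabet `x₁^±, …, x_m^±`; the letter `(i, true)` is `xᵢ`, the letter
`(i, false)` is its inverse. -/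
abbrev Word (m : ℕ) : Type := List (Fin m × Bool)

theorem finite_relators (m ℓ : ℕ) :
    {w : Word m | FreeGroup.IsCyclicallyReduced w ∧ w.length ≤ ℓ}.Finite :=
  (List.finite_length_le (Fin m × Bool) ℓ).subset fun _ hw => hw.2

/-- `B_ℓ`: the finite set of cyclically reduced words of length at most `ℓ`. -/
noncomputable def B (m ℓ : ℕ) : Finset (Word m) :=
  (finite_relators m ℓ).toFinset

/-! ### Random subsets and density -/

/-- The density `log_{|E|} |A|` of a subset `A` of a finite set `E`, with value `-∞` when `A` is
empty. -/
noncomputable def density {α : Type*} (E : Finset α) (A : Finset E) : EReal :=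
  if A.card = 0 then ⊥ else ((Real.logb E.card A.card : ℝ) : EReal)

/-- The property `Q_ℓ` holds asymptotically almost surely. -/
def AAS {Ω : ℕ → Type*} [∀ ℓ, MeasurableSpace (Ω ℓ)] (P : ∀ ℓ, Measure (Ω ℓ))
    (Q : ∀ ℓ, Ω ℓ → Prop) : Prop :=
  Tendsto (fun ℓ => P ℓ {ω | Q ℓ ω}) atTop (𝓝 1)

/-- `R` is a random variable with values in the (finite) set of subsets of `E`. -/
def IsRandomSubset {Ω α : Type*} [MeasurableSpace Ω] {E : Finset α} (R : Ω → Finset E) : Prop :=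
  ∀ A : Finset E, MeasurableSet {ω | R ω = A}

/-- The law of the random subset `R` of `E` is invariant under all permutations of `E`. -/
def IsPermutationInvariant {Ω α : Type*} [MeasurableSpace Ω] (P : Measure Ω) {E : Finset α}
    (R : Ω → Finset E) : Prop :=
  ∀ (σ : Equiv.Perm E) (A : Finset E),
    P {ω | R ω = A.map σ.toEmbedding} = P {ω | R ω = A}

/-- The sequence `(R_ℓ)` of random subsets of `(E_ℓ)` is densable with density `d`: the random
variables `log_{|E_ℓ|} |R_ℓ|`, with values in the extended reals, converge in probability to the
constant `d`. (For `|E_ℓ| → ∞` this forces `d ∈ {-∞} ∪ [0, 1]`.) -/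
def IsDensable {Ω : ℕ → Type*} [∀ ℓ, MeasurableSpace (Ω ℓ)] (P : ∀ ℓ, Measure (Ω ℓ))
    {α : Type*} {E : ℕ → Finset α} (R : ∀ ℓ, Ω ℓ → Finset (E ℓ)) (d : EReal) : Prop :=
  ∀ U ∈ 𝓝 d, AAS P fun ℓ ω => density (E ℓ) (R ℓ ω) ∈ U

/-- `(R_ℓ)` is the sequence of relator sets of a sequence of random groups
`G_ℓ(m, d) = ⟨x₁, …, x_m | R_ℓ⟩` with `m` generators at density `d`. -/
structure IsRandomGroupSequence {Ω : ℕ → Type*} [∀ ℓ, MeasurableSpace (Ω ℓ)]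
    (P : ∀ ℓ, Measure (Ω ℓ)) (m : ℕ) (d : EReal) (R : ∀ ℓ, Ω ℓ → Finset (B m ℓ)) : Prop where
  randomSubset : ∀ ℓ, IsRandomSubset (R ℓ)
  permutationInvariant : ∀ ℓ, IsPermutationInvariant (P ℓ) (R ℓ)
  densable : IsDensable P R d

/-- The underlying set of words of a subset of `B_ℓ`. -/
def relators {m ℓ : ℕ} (A : Finset (B m ℓ)) : Set (Word m) :=
  Subtype.val '' (A : Set (B m ℓ))

/-! ### Small cancellation -/

/-- The word `r` or its formal inverse `r⁻¹`. -/
def orient {m : ℕ} (r : Word m) : Bool → Word m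
  | true => r
  | false => FreeGroup.invRev r

/-- `w` is the cyclic subword of `r` (if `ε = true`) or of `r⁻¹` (if `ε = false`) that starts
at position `i`; its length is at most that of `r`. -/
def OccursAt {m : ℕ} (w r : Word m) (ε : Bool) (i : ℕ) : Prop :=
  i < r.length ∧ w <+: (orient r ε).rotate i

/-- A piece with respect to a set `S` of relators: a cyclic subword of the relators and their
inverses that appears at least twice, in different relators, or in the same relator at different
positions or in opposite directions. -/
def IsPiece {m : ℕ} (S : Set (Word m)) (w : Word m) : Prop :=
  ∃ r₁ ∈ S, ∃ r₂ ∈ S, ∃ (ε₁ ε₂ : Bool) (i₁ i₂ : ℕ),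
    OccursAt w r₁ ε₁ i₁ ∧ OccursAt w r₂ ε₂ i₂ ∧ (r₁, ε₁, i₁) ≠ (r₂, ε₂, i₂)

/-- The small cancellation condition `C'(lam)`: the length of a piece is at most `lam` times the
length of any relator in which it appears. -/
def SmallCancellation {m : ℕ} (lam : ℝ) (S : Set (Word m)) : Prop :=
  ∀ w, IsPiece S w → ∀ r ∈ S, (∃ (ε : Bool) (i : ℕ), OccursAt w r ε i) →
    (w.length : ℝ) ≤ lam * (r.length : ℝ)

end RandomGroup

/-!
Given its cardinality `k`, a permutation invariant random subset of `B_ℓ` is uniformly distributed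
among the subsets with `k` elements, and at density `d` we have `k ≈ |B_ℓ| ^ d`, so everything
reduces to counting `k`-element subsets of `B_ℓ`.

A common cyclic subword of length greater than `λ ℓ` determines a proportion `λ` of the letters of
the second word, so about `|B_ℓ| ^ (2 - λ)` pairs of words share one, and about `|B_ℓ| ^ (2 d - λ)`
of these pairs are expected to be pairs of relators: this tends to `0` when `d < λ / 2`. A subword
occurring twice in the same word determines, by overlapping itself, only about half of its letters,
which gives about `|B_ℓ| ^ (1 - λ / 2)` words and the same threshold.

Conversely, under `C'(λ)` the relators have distinct prefixes of length just above `λ ℓ`. There are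
about `|B_ℓ| ^ λ` such prefixes, so by the birthday paradox `|B_ℓ| ^ d` relators have two equal ones
as soon as `d > λ / 2`.
-/

namespace RandomGroup

open Finset

section AsymptoticallyAlmostSurely

variable {Ω : ℕ → Type*} [∀ ℓ, MeasurableSpace (Ω ℓ)] {P : ∀ ℓ, Measure (Ω ℓ)}
  [∀ ℓ, IsProbabilityMeasure (P ℓ)] {Q Q' : ∀ ℓ, Ω ℓ → Prop}

theorem AAS.mono_eventually (h : AAS P Q) (hQ : ∀ᶠ ℓ in atTop, ∀ ω, Q ℓ ω → Q' ℓ ω) :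
    AAS P Q' :=
  tendsto_of_tendsto_of_tendsto_of_le_of_le' h tendsto_const_nhds
    (hQ.mono fun _ hℓ => measure_mono hℓ) (.of_forall fun _ => prob_le_one)

theorem AAS.of_tendsto_measureReal_not_and (h : AAS P Q)
    (hQ' : Tendsto (fun ℓ => (P ℓ).real {ω | ¬ Q' ℓ ω ∧ Q ℓ ω}) atTop (𝓝 0)) : AAS P Q' := by
  have hsub : Tendsto (fun ℓ => P ℓ {ω | Q ℓ ω} - P ℓ {ω | ¬ Q' ℓ ω ∧ Q ℓ ω}) atTop (𝓝 1) := by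
    have hQ'0 := ENNReal.tendsto_ofReal hQ'
    simp only [measureReal_def, ENNReal.ofReal_zero,
      ENNReal.ofReal_toReal (measure_ne_top (P _) _)] at hQ'0
    simpa using ENNReal.Tendsto.sub h hQ'0 (.inl ENNReal.one_ne_top)
  refine tendsto_of_tendsto_of_tendsto_of_le_of_le hsub tendsto_const_nhds (fun ℓ => ?_)
    fun ℓ => prob_le_one
  refine tsub_le_iff_right.2 (le_trans (measure_mono fun ω hω => ?_) (measure_union_le _ _))
  by_cases hQω : Q' ℓ ω
  · exact .inl hQω
  · exact .inr ⟨hQω, hω⟩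

end AsymptoticallyAlmostSurely

section RandomSubset

variable {Ω α : Type*} [MeasurableSpace Ω] {P : Measure Ω} {E : Finset α} {R : Ω → Finset E}

theorem IsRandomSubset.measurableSet_mem (hR : IsRandomSubset R) (S : Finset (Finset E)) :
    MeasurableSet {ω | R ω ∈ S} := by
  have : {ω | R ω ∈ S} = ⋃ A ∈ S, {ω | R ω = A} := by ext; simp
  exact this ▸ S.measurableSet_biUnion fun A _ => hR A

theorem IsRandomSubset.measureReal_mem_eq_sum [IsFiniteMeasure P] (hR : IsRandomSubset R)
    (S : Finset (Finset E)) : P.real {ω | R ω ∈ S} = ∑ A ∈ S, P.real {ω | R ω = A} := by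
  rw [← measureReal_biUnion_finset _ fun A _ => hR A]
  · congr 1
    ext
    simp
  · exact fun A _ B _ hAB => Set.disjoint_left.2 fun ω hA hB => hAB (hA.symm.trans hB)

theorem exists_perm_map_eq_of_card_eq {β : Type*} [Finite β] {A B : Finset β}
    (h : #A = #B) : ∃ σ : Equiv.Perm β, A.map σ.toEmbedding = B := by
  classical
  have := Fintype.ofFinite β
  let e : A ≃ B := equivOfCardEq h
  refine ⟨e.extendSubtype, eq_of_subset_of_card_le (fun x hx => ?_) (by simp [h])⟩
  obtain ⟨y, hy, rfl⟩ := mem_map.1 hx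
  exact e.extendSubtype_mem y hy

theorem IsPermutationInvariant.measureReal_eq_of_card_eq (hinv : IsPermutationInvariant P R)
    {A B : Finset E} (h : #A = #B) : P.real {ω | R ω = A} = P.real {ω | R ω = B} := by
  obtain ⟨σ, rfl⟩ := exists_perm_map_eq_of_card_eq h
  exact congrArg ENNReal.toReal (hinv σ A).symm

theorem IsPermutationInvariant.measureReal_mem_eq_card_mul [IsFiniteMeasure P]
    (hinv : IsPermutationInvariant P R) (hR : IsRandomSubset R) {S : Finset (Finset E)}
    {A : Finset E} (hS : ∀ B ∈ S, #B = #A) :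
    P.real {ω | R ω ∈ S} = #S * P.real {ω | R ω = A} := by
  rw [hR.measureReal_mem_eq_sum,
    sum_congr rfl fun B hB => hinv.measureReal_eq_of_card_eq (hS B hB), sum_const, nsmul_eq_mul]

variable {F : Finset E → Prop} [DecidablePred F] {ε : ℝ}

theorem IsPermutationInvariant.measureReal_and_card_eq_le [IsFiniteMeasure P]
    (hinv : IsPermutationInvariant P R) (hR : IsRandomSubset R) {k : ℕ}
    (hF : #{A ∈ powersetCard k univ | F A} ≤ ε * (#E).choose k) :
    P.real {ω | F (R ω) ∧ #(R ω) = k} ≤ ε * P.real {ω | #(R ω) = k} := by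
  by_cases hk : ∃ ω, #(R ω) = k
  · obtain ⟨ω₀, hω₀⟩ := hk
    have hcard : ∀ B ∈ powersetCard k (univ : Finset E), #B = #(R ω₀) := fun B hB =>
      (mem_powersetCard.1 hB).2.trans hω₀.symm
    have hall := hinv.measureReal_mem_eq_card_mul hR hcard
    have hbad := hinv.measureReal_mem_eq_card_mul hR
      (S := {A ∈ powersetCard k univ | F A}) fun B hB => hcard B (mem_filter.1 hB).1
    simp only [mem_powersetCard_univ, card_powersetCard, card_univ, Fintype.card_coe] at hall
    simp only [mem_filter, mem_powersetCard_univ, and_comm (a := #_ = k)] at hbad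
    rw [hall, hbad, ← mul_assoc]
    exact mul_le_mul_of_nonneg_right hF measureReal_nonneg
  · push Not at hk
    simp [hk]

theorem IsPermutationInvariant.measureReal_and_card_mem_le [IsProbabilityMeasure P]
    (hinv : IsPermutationInvariant P R) (hR : IsRandomSubset R) {K : Set ℕ} (hε : 0 ≤ ε)
    (hF : ∀ k ∈ K, #{A ∈ powersetCard k univ | F A} ≤ ε * (#E).choose k) :
    P.real {ω | F (R ω) ∧ #(R ω) ∈ K} ≤ ε := by
  classical
  let I : Finset ℕ := {k ∈ range (#E + 1) | k ∈ K}
  have hI : ∀ ω, #(R ω) ∈ K → #(R ω) ∈ I := fun ω hω => by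
    have := card_le_univ (R ω)
    rw [Fintype.card_coe] at this
    exact mem_filter.2 ⟨mem_range.2 (by lia), hω⟩
  calc P.real {ω | F (R ω) ∧ #(R ω) ∈ K}
    _ ≤ P.real (⋃ k ∈ I, {ω | F (R ω) ∧ #(R ω) = k}) := measureReal_mono
        (fun ω hω => Set.mem_biUnion (hI ω hω.2) ⟨hω.1, rfl⟩) (measure_ne_top P _)
    _ ≤ ∑ k ∈ I, P.real {ω | F (R ω) ∧ #(R ω) = k} := measureReal_biUnion_finset_le _ _
    _ ≤ ∑ k ∈ I, ε * P.real {ω | #(R ω) = k} := sum_le_sum fun k hk =>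
        hinv.measureReal_and_card_eq_le hR (hF k (mem_filter.1 hk).2)
    _ = ε * P.real (⋃ k ∈ I, {ω | #(R ω) = k}) := by
        rw [← mul_sum, measureReal_biUnion_finset]
        · exact fun i _ j _ hij => Set.disjoint_left.2 fun ω hi hj => hij (hi.symm.trans hj)
        · exact fun k _ => by
            simpa only [mem_powersetCard_univ] using hR.measurableSet_mem (powersetCard k univ)
    _ ≤ ε := mul_le_of_le_one_right hε measureReal_le_one

end RandomSubset

section Density

variable {Ω : ℕ → Type*} [∀ ℓ, MeasurableSpace (Ω ℓ)] {P : ∀ ℓ, Measure (Ω ℓ)}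
  [∀ ℓ, IsProbabilityMeasure (P ℓ)] {α : Type*} {E : ℕ → Finset α} {R : ∀ ℓ, Ω ℓ → Finset (E ℓ)}

theorem aas_not_of_card_filter_le (hR : ∀ ℓ, IsRandomSubset (R ℓ))
    (hinv : ∀ ℓ, IsPermutationInvariant (P ℓ) (R ℓ)) {F : ∀ ℓ, Finset (E ℓ) → Prop}
    [∀ ℓ, DecidablePred (F ℓ)] {K : ℕ → Set ℕ} (hK : AAS P fun ℓ ω => #(R ℓ ω) ∈ K ℓ)
    {ε : ℕ → ℝ} (hε : Tendsto ε atTop (𝓝 0))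
    (hF : ∀ᶠ ℓ in atTop, ∀ k ∈ K ℓ,
      #{A ∈ powersetCard k univ | F ℓ A} ≤ ε ℓ * (#(E ℓ)).choose k) :
    AAS P fun ℓ ω => ¬ F ℓ (R ℓ ω) := by
  refine hK.of_tendsto_measureReal_not_and (squeeze_zero' (.of_forall fun _ => measureReal_nonneg)
    ?_ (abs_zero (α := ℝ) ▸ hε.abs))
  filter_upwards [hF] with ℓ hℓ
  simp only [not_not]
  exact (hinv ℓ).measureReal_and_card_mem_le (hR ℓ) (abs_nonneg _) fun k hk =>
    (hℓ k hk).trans (mul_le_mul_of_nonneg_right (le_abs_self _) (Nat.cast_nonneg _))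

theorem card_le_rpow_of_density_lt {s : Finset α} (hs : 1 < #s) {A : Finset s} {x : ℝ}
    (h : density s A < x) : (#A : ℝ) ≤ (#s : ℝ) ^ x := by
  rcases eq_or_ne #A 0 with hA | hA
  · rw [hA, Nat.cast_zero]
    positivity
  · rw [density, if_neg hA, EReal.coe_lt_coe_iff] at h
    exact ((Real.logb_lt_iff_lt_rpow (mod_cast hs) (by positivity)).1 h).le

theorem rpow_le_card_of_lt_density {s : Finset α} (hs : 1 < #s) {A : Finset s} {x : ℝ}
    (h : x < density s A) : (#s : ℝ) ^ x ≤ #A := by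
  rcases eq_or_ne #A 0 with hA | hA
  · simp [density, hA] at h
  · rw [density, if_neg hA, EReal.coe_lt_coe_iff] at h
    exact ((Real.lt_logb_iff_rpow_lt (mod_cast hs) (by positivity)).1 h).le

variable {d : EReal} {x : ℝ}

theorem IsDensable.aas_card_le_rpow (h : IsDensable P R d) (hE : ∀ᶠ ℓ in atTop, 1 < #(E ℓ))
    (hx : d < x) : AAS P fun ℓ ω => (#(R ℓ ω) : ℝ) ≤ (#(E ℓ) : ℝ) ^ x :=
  (h _ (Iio_mem_nhds hx)).mono_eventually <| hE.mono fun _ hℓ _ => card_le_rpow_of_density_lt hℓ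

theorem IsDensable.aas_rpow_le_card (h : IsDensable P R d) (hE : ∀ᶠ ℓ in atTop, 1 < #(E ℓ))
    (hx : x < d) : AAS P fun ℓ ω => (#(E ℓ) : ℝ) ^ x ≤ #(R ℓ ω) :=
  (h _ (Ioi_mem_nhds hx)).mono_eventually <| hE.mono fun _ hℓ _ => rpow_le_card_of_lt_density hℓ

end Density

section FirstMoment

theorem choose_le_div_pow_mul_choose {N k : ℕ} (h : k ≤ N) (f : ℕ) :
    (N.choose k : ℝ) ≤ (((k + f : ℕ) : ℝ) / (N + f : ℕ)) ^ f * (N + f).choose (k + f) := by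
  induction f with
  | zero => simp
  | succ f ih =>
    have hC : ((N + f).choose (k + f) : ℝ) =
        ((k + (f + 1) : ℕ) : ℝ) / (N + (f + 1) : ℕ) * (N + (f + 1)).choose (k + (f + 1)) := by
      rw [div_mul_eq_mul_div, eq_div_iff (by positivity), mul_comm,
        mul_comm ((k + (f + 1) : ℕ) : ℝ)]
      exact_mod_cast Nat.add_one_mul_choose_eq (N + f) (k + f)
    have hratio : ((k + f : ℕ) : ℝ) / (N + f : ℕ) ≤
        ((k + (f + 1) : ℕ) : ℝ) / (N + (f + 1) : ℕ) := by
      have hkN : (k : ℝ) ≤ N := mod_cast h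
      rcases Nat.eq_zero_or_pos (N + f) with h0 | hpos
      · rw [h0, Nat.cast_zero, div_zero]
        positivity
      · rw [div_le_div_iff₀ (mod_cast hpos) (by positivity)]
        push_cast
        linarith
    calc (N.choose k : ℝ)
      _ ≤ _ := ih
      _ ≤ (((k + (f + 1) : ℕ) : ℝ) / (N + (f + 1) : ℕ)) ^ f * (N + f).choose (k + f) := by gcongr
      _ = _ := by rw [hC, pow_succ, mul_assoc]

variable {α ι : Type*}

theorem card_filter_powersetCard_subset_le [DecidableEq α] (s t : Finset α) (k : ℕ) :
    (#{A ∈ powersetCard k t | s ⊆ A} : ℝ) ≤ (k / #t : ℝ) ^ #s * (#t).choose k := by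
  rcases eq_empty_or_nonempty {A ∈ powersetCard k t | s ⊆ A} with h0 | ⟨A, hA⟩
  · rw [h0, card_empty, Nat.cast_zero]
    positivity
  · obtain ⟨⟨hAt, rfl⟩, hsA⟩ := by simpa only [mem_filter, mem_powersetCard] using hA
    rw [card_filter_powersetCard_subset s t _ (hsA.trans hAt) (card_le_card hsA)]
    have hAs := card_le_card hsA
    have htA := card_le_card hAt
    have h := choose_le_div_pow_mul_choose (Nat.sub_le_sub_right htA #s) #s
    rwa [Nat.sub_add_cancel hAs, Nat.sub_add_cancel (hAs.trans htA)] at h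

theorem card_filter_powersetCard_exists_subset_le [DecidableEq α] (I : Finset ι)
    (f : ι → Finset α) (t : Finset α) (k : ℕ) :
    (#{A ∈ powersetCard k t | ∃ i ∈ I, f i ⊆ A} : ℝ) ≤
      (∑ i ∈ I, (k / #t : ℝ) ^ #(f i)) * (#t).choose k := by
  have hsub : {A ∈ powersetCard k t | ∃ i ∈ I, f i ⊆ A} ⊆
      I.biUnion fun i => {A ∈ powersetCard k t | f i ⊆ A} := fun A hA => by
    obtain ⟨hAk, i, hi, hiA⟩ := mem_filter.1 hA
    exact mem_biUnion.2 ⟨i, hi, mem_filter.2 ⟨hAk, hiA⟩⟩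
  rw [sum_mul]
  calc (#{A ∈ powersetCard k t | ∃ i ∈ I, f i ⊆ A} : ℝ)
    _ ≤ ∑ i ∈ I, (#{A ∈ powersetCard k t | f i ⊆ A} : ℝ) :=
        mod_cast (card_le_card hsub).trans card_biUnion_le
    _ ≤ _ := sum_le_sum fun i _ => card_filter_powersetCard_subset_le (f i) t k

theorem card_filter_powersetCard_exists_rel_le (r : α → α → Prop) [DecidableRel r]
    (t : Finset α) (k : ℕ) :
    (#{A ∈ powersetCard k t | ∃ a ∈ A, ∃ b ∈ A, r a b} : ℝ) ≤
      (#{x ∈ t ×ˢ t | r x.1 x.2} * (k / #t : ℝ) ^ 2 + #{a ∈ t | r a a} * (k / #t : ℝ)) *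
        (#t).choose k := by
  classical
  let D : Finset (α × α) := {x ∈ t ×ˢ t | r x.1 x.2 ∧ x.1 ≠ x.2}
  let S : Finset α := {a ∈ t | r a a}
  let I : Finset (α × α ⊕ α) := D.disjSum S
  let f : α × α ⊕ α → Finset α := Sum.elim (fun x => {x.1, x.2}) singleton
  have hsub : ∀ A ∈ powersetCard k t, (∃ a ∈ A, ∃ b ∈ A, r a b) → ∃ i ∈ I, f i ⊆ A := by
    rintro A hA ⟨a, ha, b, hb, hab⟩
    have hAt := (mem_powersetCard.1 hA).1
    by_cases h : a = b
    · subst h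
      exact ⟨.inr a, by simp [I, S, hAt ha, hab], by simpa [f] using ha⟩
    · exact ⟨.inl (a, b), by simp [I, D, hAt ha, hAt hb, hab, h],
        by simp [f, insert_subset_iff, ha, hb]⟩
  have hsum : ∑ i ∈ I, (k / #t : ℝ) ^ #(f i) = #D * (k / #t : ℝ) ^ 2 + #S * (k / #t : ℝ) := by
    have hD : ∀ x ∈ D, #({x.1, x.2} : Finset α) = 2 := fun x hx =>
      card_pair (mem_filter.1 hx).2.2
    rw [sum_disjSum]
    simp +contextual [f, hD]
  refine (Nat.cast_le.2 (card_le_card fun A hA => ?_)).trans <|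
    (card_filter_powersetCard_exists_subset_le I f t k).trans ?_
  · exact mem_filter.2 ⟨(mem_filter.1 hA).1, hsub A (mem_filter.1 hA).1 (mem_filter.1 hA).2⟩
  · have hDr : #D ≤ #{x ∈ t ×ˢ t | r x.1 x.2} :=
      card_le_card (monotone_filter_right _ fun _ _ h => h.1)
    rw [hsum]
    gcongr

end FirstMoment

section Birthday

theorem pow_succ_add_le_add_pow {s t : ℝ} (hs : 0 ≤ s) (hst : 0 ≤ s + t) (n : ℕ) :
    s ^ (n + 1) + (n + 1) * s ^ n * t ≤ (s + t) ^ (n + 1) := by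
  induction n with
  | zero => simp
  | succ n ih =>
    calc s ^ (n + 2) + ((n + 1 : ℕ) + 1) * s ^ (n + 1) * t
      _ ≤ s ^ (n + 2) + ((n + 1 : ℕ) + 1) * s ^ (n + 1) * t + (n + 1) * s ^ n * t ^ 2 :=
          le_add_of_nonneg_right (by positivity)
      _ = (s + t) * (s ^ (n + 1) + (n + 1) * s ^ n * t) := by push_cast; ring
      _ ≤ (s + t) * (s + t) ^ (n + 1) := by gcongr
      _ = (s + t) ^ (n + 2) := by ring

theorem sum_powersetCard_insert_prod {ι R : Type*} [DecidableEq ι] [CommSemiring R] (x : ι → R)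
    {s : Finset ι} {a : ι} (ha : a ∉ s) (k : ℕ) :
    ∑ t ∈ powersetCard (k + 1) (insert a s), ∏ i ∈ t, x i =
      ∑ t ∈ powersetCard (k + 1) s, ∏ i ∈ t, x i + x a * ∑ t ∈ powersetCard k s, ∏ i ∈ t, x i := by
  have hnot : ∀ {j t}, t ∈ powersetCard j s → a ∉ t := fun ht h => ha ((mem_powersetCard.1 ht).1 h)
  rw [powersetCard_succ_insert ha, sum_union, sum_image, mul_sum]
  · exact congrArg _ (sum_congr rfl fun t ht => prod_insert (hnot ht))
  · intro t ht u hu htu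
    rw [← erase_insert (hnot ht), htu, erase_insert (hnot hu)]
  · refine disjoint_left.2 fun t ht ht' => ?_
    obtain ⟨u, -, rfl⟩ := mem_image.1 ht'
    exact hnot ht (mem_insert_self a u)

/- Maclaurin's inequality. Adding a term `y` to `M` terms of mean `μ` moves the mean by
`(y - μ) / (M + 1)`, and Bernoulli's inequality at `μ` compares the two elementary symmetric
polynomials. -/
theorem sum_powersetCard_prod_le_choose_mul_pow {ι : Type*} (s : Finset ι) {x : ι → ℝ}
    (hx : ∀ i, 0 ≤ x i) (k : ℕ) :
    ∑ t ∈ powersetCard k s, ∏ i ∈ t, x i ≤ (#s).choose k * ((∑ i ∈ s, x i) / #s) ^ k := by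
  classical
  induction s using Finset.induction_on generalizing k with
  | empty =>
    rcases k with _ | k
    · simp
    · rw [powersetCard_eq_empty.2 (by simp), sum_empty]
      positivity
  | insert a s ha ih =>
    rcases k with _ | k
    · simp
    obtain ⟨μ, hμ⟩ : ∃ μ, (∑ i ∈ s, x i) / #s = μ := ⟨_, rfl⟩
    obtain ⟨δ, hδ⟩ : ∃ δ, δ * (#s + 1) = x a - μ :=
      ⟨_, div_mul_cancel₀ _ (Nat.cast_add_one_ne_zero #s)⟩
    have hμ0 : 0 ≤ μ := hμ ▸ div_nonneg (sum_nonneg fun i _ => hx i) (Nat.cast_nonneg _)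
    have hsum : ∑ i ∈ s, x i = μ * #s := by
      rcases s.eq_empty_or_nonempty with rfl | hs
      · simp
      · rw [← hμ, div_mul_cancel₀ _ (by simpa using hs.ne_empty)]
    have hmean : (∑ i ∈ insert a s, x i) / #(insert a s) = μ + δ := by
      rw [sum_insert ha, card_insert_of_notMem ha, Nat.cast_add_one, hsum,
        div_eq_iff (Nat.cast_add_one_ne_zero #s)]
      linear_combination -hδ
    have hmean0 : 0 ≤ μ + δ := hmean ▸ div_nonneg (sum_nonneg fun i _ => hx i) (Nat.cast_nonneg _)
    have hpascal : ((#s + 1).choose (k + 1) : ℝ) = (#s).choose k + (#s).choose (k + 1) :=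
      mod_cast Nat.choose_succ_succ #s k
    have habsorb : ((#s + 1).choose (k + 1) : ℝ) * (k + 1) = (#s + 1) * (#s).choose k :=
      mod_cast (Nat.add_one_mul_choose_eq #s k).symm
    rw [hmean, card_insert_of_notMem ha]
    calc ∑ t ∈ powersetCard (k + 1) (insert a s), ∏ i ∈ t, x i
      _ = ∑ t ∈ powersetCard (k + 1) s, ∏ i ∈ t, x i +
            x a * ∑ t ∈ powersetCard k s, ∏ i ∈ t, x i :=
          sum_powersetCard_insert_prod x ha k
      _ ≤ (#s).choose (k + 1) * μ ^ (k + 1) + x a * ((#s).choose k * μ ^ k) := by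
          gcongr
          exacts [hμ ▸ ih (k + 1), hx a, hμ ▸ ih k]
      _ = (#s + 1).choose (k + 1) * (μ ^ (k + 1) + (k + 1) * μ ^ k * δ) := by
          linear_combination
            -μ ^ (k + 1) * hpascal - δ * μ ^ k * habsorb - (#s).choose k * μ ^ k * hδ
      _ ≤ (#s + 1).choose (k + 1) * (μ + δ) ^ (k + 1) := by
          gcongr
          exact pow_succ_add_le_add_pow hμ0 hmean0 k

theorem one_sub_div_le_exp_mul_one_sub_div {k M N : ℝ} (hk : 0 ≤ k) (hM : 0 < M) (hMN : M ≤ N)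
    (hkN : k ≤ N) : 1 - k / M ≤ Real.exp (-(k * (1 / M - 1 / N))) * (1 - k / N) := by
  have hN : 0 < N := hM.trans_le hMN
  have hexponent : 0 ≤ k * (1 / M - 1 / N) :=
    mul_nonneg hk (sub_nonneg.2 (one_div_le_one_div_of_le hM hMN))
  calc 1 - k / M
    _ = 1 - k / N - k * (1 / M - 1 / N) := by ring
    _ ≤ (1 - k * (1 / M - 1 / N)) * (1 - k / N) := by
        have : 0 ≤ k * (1 / M - 1 / N) * (k / N) := by positivity
        linarith
    _ ≤ Real.exp (-(k * (1 / M - 1 / N))) * (1 - k / N) :=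
        mul_le_mul_of_nonneg_right (Real.one_sub_le_exp_neg _)
          (sub_nonneg.2 ((div_le_one hN).2 hkN))

theorem choose_mul_div_pow_le_exp_mul_choose {M N : ℕ} (hM : 0 < M) (hMN : M ≤ N) (k : ℕ) :
    (M.choose k : ℝ) * (N / M : ℝ) ^ k ≤
      Real.exp (-(k * (k - 1) / 2 * (1 / M - 1 / N))) * N.choose k := by
  induction k with
  | zero => simp
  | succ k ih =>
    rcases le_or_gt M k with hk | hk
    · rw [Nat.choose_eq_zero_of_lt (by lia), Nat.cast_zero, zero_mul]
      positivity
    have hM0 : (0 : ℝ) < M := mod_cast hM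
    have hMN' : (M : ℝ) ≤ N := mod_cast hMN
    have hN0 : (0 : ℝ) < N := hM0.trans_le hMN'
    have hkM : (k : ℝ) ≤ M := mod_cast hk.le
    have hsucc : ∀ n : ℕ, k ≤ n →
        (n.choose (k + 1) : ℝ) = n.choose k * (n - k) / (k + 1) := fun n hn => by
      rw [eq_div_iff (by positivity), ← Nat.cast_sub hn]
      exact_mod_cast Nat.choose_succ_right_eq n k
    calc (M.choose (k + 1) : ℝ) * (N / M : ℝ) ^ (k + 1)
      _ = M.choose k * (N / M : ℝ) ^ k * (1 - k / M) * (N / (k + 1)) := by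
          rw [hsucc M hk.le, pow_succ]
          field_simp
      _ ≤ Real.exp (-(k * (k - 1) / 2 * (1 / M - 1 / N))) * N.choose k *
            (Real.exp (-(k * (1 / M - 1 / N))) * (1 - k / N)) * (N / (k + 1)) := by
          have : (0 : ℝ) ≤ 1 - k / M := sub_nonneg.2 ((div_le_one hM0).2 hkM)
          gcongr
          exact one_sub_div_le_exp_mul_one_sub_div k.cast_nonneg hM0 hMN' (hkM.trans hMN')
      _ = Real.exp (-(k * (k - 1) / 2 * (1 / M - 1 / N))) * Real.exp (-(k * (1 / M - 1 / N))) *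
            N.choose (k + 1) := by
          rw [hsucc N (by lia)]
          field_simp
      _ = _ := by
          rw [← Real.exp_add]
          congr 2
          push_cast
          ring

variable {α β : Type*} [DecidableEq β] (c : α → β) (t : Finset α) (k : ℕ)

theorem card_filter_powersetCard_card_image_eq_le_sum :
    #{A ∈ powersetCard k t | #(A.image c) = k} ≤
      ∑ T ∈ powersetCard k (t.image c), ∏ b ∈ T, #{a ∈ t | c a = b} := by
  classical
  let transversal (T : Finset β) (g : ∀ b ∈ T, α) : Finset α := T.attach.image fun b : T => g b b.2
  have hsub : {A ∈ powersetCard k t | #(A.image c) = k} ⊆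
      (powersetCard k (t.image c)).biUnion fun T =>
        (T.pi fun b => {a ∈ t | c a = b}).image (transversal T) := fun A hA => by
    obtain ⟨⟨hAt, hAk⟩, hck⟩ := by simpa only [mem_filter, mem_powersetCard] using hA
    have hinj : Set.InjOn c A := card_image_iff.1 (hck.trans hAk.symm)
    choose g hgA hgc using fun b (hb : b ∈ A.image c) => mem_image.1 hb
    refine mem_biUnion.2 ⟨A.image c, mem_powersetCard.2 ⟨image_subset_image hAt, hck⟩, mem_image.2
      ⟨g, mem_pi.2 fun b hb => mem_filter.2 ⟨hAt (hgA b hb), hgc b hb⟩, ?_⟩⟩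
    have hg : ∀ a (ha : a ∈ A), g (c a) (mem_image_of_mem c ha) = a := fun a ha =>
      hinj (hgA _ _) ha (hgc _ _)
    ext a
    rw [mem_image]
    constructor
    · rintro ⟨⟨b, hb⟩, -, rfl⟩
      exact hgA b hb
    · exact fun ha => ⟨⟨c a, mem_image_of_mem c ha⟩, mem_attach _ _, hg a ha⟩
  refine (card_le_card hsub).trans (card_biUnion_le.trans (sum_le_sum fun T _ => ?_))
  exact card_image_le.trans_eq (card_pi T _)

theorem card_filter_powersetCard_card_image_eq_le (hc : 2 * #(t.image c) ≤ #t) (hk : 2 ≤ k) :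
    (#{A ∈ powersetCard k t | #(A.image c) = k} : ℝ) ≤
      8 * #(t.image c) / (k : ℝ) ^ 2 * (#t).choose k := by
  rcases Nat.eq_zero_or_pos #(t.image c) with hM0 | hM0
  · have ht : #t < k := by
      rw [image_eq_empty.1 (card_eq_zero.1 hM0), card_empty]
      lia
    rw [powersetCard_eq_empty.2 ht, filter_empty, card_empty, Nat.cast_zero]
    positivity
  have hk2 : (2 : ℝ) ≤ k := mod_cast hk
  have hfrac : 1 / (2 * #(t.image c) : ℝ) ≤ 1 / #(t.image c) - 1 / #t := by
    have : 1 / (#t : ℝ) ≤ 1 / (2 * #(t.image c)) := by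
      gcongr
      exact_mod_cast hc
    calc 1 / (2 * #(t.image c) : ℝ)
      _ = 1 / #(t.image c) - 1 / (2 * #(t.image c)) := by field_simp; norm_num
      _ ≤ _ := by linarith
  have hexponent : (k : ℝ) ^ 2 / (8 * #(t.image c)) ≤
      k * (k - 1) / 2 * (1 / #(t.image c) - 1 / #t) :=
    calc (k : ℝ) ^ 2 / (8 * #(t.image c))
      _ = k ^ 2 / 4 * (1 / (2 * #(t.image c))) := by field_simp; norm_num
      _ ≤ k * (k - 1) / 2 * (1 / #(t.image c) - 1 / #t) := by
          gcongr ?_ * ?_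
          · nlinarith
          · nlinarith
  calc (#{A ∈ powersetCard k t | #(A.image c) = k} : ℝ)
    _ ≤ ∑ T ∈ powersetCard k (t.image c), ∏ b ∈ T, (#{a ∈ t | c a = b} : ℝ) :=
        mod_cast card_filter_powersetCard_card_image_eq_le_sum c t k
    _ ≤ (#(t.image c)).choose k * ((∑ b ∈ t.image c, (#{a ∈ t | c a = b} : ℝ)) /
          #(t.image c)) ^ k :=
        sum_powersetCard_prod_le_choose_mul_pow _ (fun _ => Nat.cast_nonneg _) k
    _ = (#(t.image c)).choose k * (#t / #(t.image c) : ℝ) ^ k := by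
        rw [← Nat.cast_sum, ← card_eq_sum_card_image]
    _ ≤ Real.exp (-(k * (k - 1) / 2 * (1 / #(t.image c) - 1 / #t))) * (#t).choose k :=
        choose_mul_div_pow_le_exp_mul_choose hM0 (by lia) k
    _ ≤ 8 * #(t.image c) / (k : ℝ) ^ 2 * (#t).choose k := by
        gcongr
        rw [Real.exp_neg, ← inv_div ((k : ℝ) ^ 2)]
        refine inv_anti₀ (by positivity) (hexponent.trans ?_)
        linarith [Real.add_one_le_exp (k * (k - 1) / 2 * (1 / #(t.image c) - 1 / #t) : ℝ)]

end Birthday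

section Chains

variable {α : Type*}

theorem eq_of_forall_take_eq_imp_getElem?_eq {u v : List α} (hlen : u.length = v.length)
    (h : ∀ p < u.length, u.take p = v.take p → u[p]? = v[p]?) : u = v := by
  have htake : ∀ p ≤ u.length, u.take p = v.take p := fun p hp => by
    induction p with
    | zero => simp
    | succ p ih => rw [List.take_add_one, List.take_add_one, ih (by lia), h p hp (ih (by lia))]
  rw [← u.take_length, htake _ le_rfl, hlen, v.take_length]

/- A chain is determined by its first letter and, at each position outside `J`, by the index of its
letter among the at most `D` successors of the preceding one. -/
theorem card_le_card_mul_pow_of_isChain [Fintype α] [Nonempty α] {R : α → α → Prop}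
    [DecidableRel R] {D : ℕ} [NeZero D] (hD : ∀ a, #{b | R a b} ≤ D) {n : ℕ} {J : Finset ℕ}
    (hJ : J ⊆ range n) {S : Finset (List α)} (hlen : ∀ w ∈ S, w.length = n)
    (hchain : ∀ w ∈ S, w.IsChain R)
    (hdet : ∀ u ∈ S, ∀ v ∈ S, ∀ p ∈ J, u.take p = v.take p → u[p]? = v[p]?) :
    #S ≤ Fintype.card α * D ^ (n - #J) := by
  obtain ⟨x₀⟩ := ‹Nonempty α›
  choose κ hκ using fun a => show ∃ f : α → Fin D, Set.InjOn f {b | R a b} by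
    obtain ⟨f, -, hf⟩ := (Set.toFinite {b | R a b}).exists_injOn_of_encard_le
      (t := (Set.univ : Set (Fin D))) (by
        classical
        rw [Set.encard_eq_coe_toFinset_card, Set.encard_univ]
        simpa using hD a)
    exact ⟨f, hf⟩
  let code (w : List α) : α × (↥(range n \ J) → Fin D) :=
    (w.getD 0 x₀, fun p => κ (w.getD (p - 1) x₀) (w.getD p x₀))
  have hinj : Set.InjOn code S := fun u hu v hv huv => by
    refine eq_of_forall_take_eq_imp_getElem?_eq ((hlen u hu).trans (hlen v hv).symm)
      fun p hpu htake => ?_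
    have hp : p < n := hpu.trans_eq (hlen u hu)
    have hpv : p < v.length := hp.trans_eq (hlen v hv).symm
    by_cases hpJ : p ∈ J
    · exact hdet u hu v hv p hpJ htake
    rcases p with _ | p
    · simpa [code, hpu, hpv] using congrArg Prod.fst huv
    · have hprev : u[p]? = v[p]? := by
          simpa only [List.getElem?_take_of_lt (Nat.lt_succ_self p)] using congrArg (·[p]?) htake
      have hcode := congrFun (congrArg Prod.snd huv) ⟨p + 1, by simp [hp, hpJ]⟩
      simp only [code, Nat.add_sub_cancel, List.getD_eq_getElem?_getD, hprev] at hcode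
      rw [List.getElem?_eq_getElem (by lia), List.getElem?_eq_getElem (by lia),
        Option.some_inj] at hprev
      rw [List.getElem?_eq_getElem hpu, List.getElem?_eq_getElem hpv]
      rw [List.getElem?_eq_getElem hpu, List.getElem?_eq_getElem hpv,
        List.getElem?_eq_getElem (by lia)] at hcode
      exact congrArg some <| hκ _ (hprev ▸ List.isChain_iff_getElem.1 (hchain u hu) p hpu)
        (List.isChain_iff_getElem.1 (hchain v hv) p hpv) hcode
  calc #S
    _ ≤ Fintype.card (α × (↥(range n \ J) → Fin D)) :=
        card_le_card_of_injOn code (fun _ _ => mem_univ _) hinj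
    _ = Fintype.card α * D ^ (n - #J) := by
        simp [card_sdiff_of_subset hJ]

end Chains

section ReducedWords

variable {m : ℕ}

/-- The formal inverse of a letter. -/
def invLetter (x : Fin m × Bool) : Fin m × Bool := (x.1, !x.2)

theorem invLetter_ne (x : Fin m × Bool) : invLetter x ≠ x := by
  simp [invLetter, Prod.ext_iff]

@[simp] theorem invLetter_invLetter (x : Fin m × Bool) : invLetter (invLetter x) = x := by
  simp [invLetter]

theorem ne_invLetter_iff (x y : Fin m × Bool) : x ≠ invLetter y ↔ (x.1 = y.1 → x.2 = y.2) := by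
  obtain ⟨i, b⟩ := x
  obtain ⟨j, c⟩ := y
  simp [invLetter]

theorem card_letters_ne (x : Fin m × Bool) : #{y | y ≠ x} = 2 * m - 1 := by
  rw [filter_ne' univ x, card_erase_of_mem (mem_univ x)]
  simp [mul_comm]

theorem isReduced_cons_iff {x : Fin m × Bool} {w : Word m} (hw : FreeGroup.IsReduced w) :
    FreeGroup.IsReduced (x :: w) ↔ ∀ y ∈ w.head?, x ≠ invLetter y := by
  simp [FreeGroup.IsReduced, List.isChain_cons, ne_invLetter_iff, show List.IsChain _ w from hw]

/-- The set of reduced words of length `n`. -/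
noncomputable def reducedWords (m n : ℕ) : Finset (Word m) :=
  ((List.finite_length_eq (Fin m × Bool) n).subset
    (t := {w : Word m | w.length = n ∧ FreeGroup.IsReduced w}) fun _ hw => hw.1).toFinset

@[simp] theorem mem_reducedWords {n : ℕ} {w : Word m} :
    w ∈ reducedWords m n ↔ w.length = n ∧ FreeGroup.IsReduced w := by
  simp [reducedWords]

theorem card_filter_reducedWords_mul_pow_le (hm : 1 ≤ m) {n : ℕ} {J : Finset ℕ} (hJ : J ⊆ range n)
    {p : Word m → Prop} [DecidablePred p]
    (hdet : ∀ u ∈ reducedWords m n, ∀ v ∈ reducedWords m n, p u → p v →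
      ∀ j ∈ J, u.take j = v.take j → u[j]? = v[j]?) :
    #{w ∈ reducedWords m n | p w} * (2 * m - 1) ^ #J ≤ 2 * m * (2 * m - 1) ^ n := by
  have : Nonempty (Fin m × Bool) := ⟨⟨0, hm⟩, true⟩
  have : NeZero (2 * m - 1) := ⟨by lia⟩
  have hsucc : ∀ x : Fin m × Bool, #{y : Fin m × Bool | x.1 = y.1 → x.2 = y.2} ≤ 2 * m - 1 :=
    fun x => by
      rw [← card_letters_ne (invLetter x)]
      refine (card_le_card fun y hy => ?_)
      simp only [mem_filter, mem_univ, true_and, ne_invLetter_iff] at hy ⊢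
      exact fun h => (hy h.symm).symm
  have hcard := card_le_card_mul_pow_of_isChain hsucc hJ (S := {w ∈ reducedWords m n | p w})
    (fun w hw => (mem_reducedWords.1 (mem_filter.1 hw).1).1)
    (fun w hw => (mem_reducedWords.1 (mem_filter.1 hw).1).2)
    (fun u hu v hv => hdet u (mem_filter.1 hu).1 v (mem_filter.1 hv).1 (mem_filter.1 hu).2
      (mem_filter.1 hv).2)
  have hJn : #J ≤ n := by simpa using card_le_card hJ
  calc #{w ∈ reducedWords m n | p w} * (2 * m - 1) ^ #J
    _ ≤ Fintype.card (Fin m × Bool) * (2 * m - 1) ^ (n - #J) * (2 * m - 1) ^ #J := by gcongr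
    _ = 2 * m * (2 * m - 1) ^ n := by
        rw [mul_assoc, ← pow_add, Nat.sub_add_cancel hJn]
        simp [mul_comm]

theorem card_reducedWords_le (hm : 1 ≤ m) (n : ℕ) :
    #(reducedWords m n) ≤ 2 * m * (2 * m - 1) ^ n := by
  simpa using card_filter_reducedWords_mul_pow_le hm (n := n) (empty_subset _)
    (p := fun _ => True) (by simp)

theorem exists_forall_ne_isReduced_cons (hm : 1 ≤ m) {w : Word m} (hw : FreeGroup.IsReduced w) :
    ∃ z, ∀ x ≠ z, FreeGroup.IsReduced (x :: w) := by
  rcases w with _ | ⟨y, w⟩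
  · exact ⟨(⟨0, hm⟩, true), fun x _ => by simp [FreeGroup.IsReduced]⟩
  · exact ⟨invLetter y, fun x hx => (isReduced_cons_iff hw).2 (by simpa using hx)⟩

theorem pow_le_card_reducedWords (hm : 1 ≤ m) (n : ℕ) :
    (2 * m - 1) ^ n ≤ #(reducedWords m n) := by
  induction n with
  | zero => exact card_pos.2 ⟨[], by simp [FreeGroup.IsReduced]⟩
  | succ n ih =>
    have htail : ∀ w ∈ reducedWords m (n + 1), w.tail ∈ reducedWords m n := fun w hw => by
      obtain ⟨hlen, hred⟩ := mem_reducedWords.1 hw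
      exact mem_reducedWords.2 ⟨by simp [hlen], hred.infix w.tail_suffix.isInfix⟩
    have hfiber : ∀ w ∈ reducedWords m n,
        2 * m - 1 ≤ #{v ∈ reducedWords m (n + 1) | v.tail = w} := fun w hw => by
      obtain ⟨hlen, hred⟩ := mem_reducedWords.1 hw
      obtain ⟨z, hz⟩ := exists_forall_ne_isReduced_cons hm hred
      rw [← card_letters_ne z]
      refine card_le_card_of_injOn (· :: w) (fun x hx => ?_) fun _ _ _ _ h => (List.cons.inj h).1
      have hxz : x ≠ z := by simpa using hx
      simp [hlen, hz x hxz]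
    calc (2 * m - 1) ^ (n + 1)
      _ = (2 * m - 1) * (2 * m - 1) ^ n := pow_succ' _ _
      _ ≤ (2 * m - 1) * #(reducedWords m n) := by gcongr
      _ ≤ #(reducedWords m (n + 1)) := mul_card_image_le_card_of_maps_to htail _ hfiber

@[simp] theorem mem_B {ℓ : ℕ} {w : Word m} :
    w ∈ B m ℓ ↔ FreeGroup.IsCyclicallyReduced w ∧ w.length ≤ ℓ := by
  simp [B]

theorem exists_isCyclicallyReduced_cons (hm : 2 ≤ m) {w : Word m} (hw : FreeGroup.IsReduced w) :
    ∃ x, FreeGroup.IsCyclicallyReduced (x :: w) := by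
  rcases w.eq_nil_or_concat' with rfl | ⟨w', y, rfl⟩
  · exact ⟨(⟨0, by lia⟩, true), by simp [FreeGroup.IsCyclicallyReduced, FreeGroup.IsReduced]⟩
  obtain ⟨z, hz⟩ := exists_forall_ne_isReduced_cons (by lia) hw
  obtain ⟨x, -, hx⟩ := exists_mem_notMem_of_card_lt_card (s := {z, invLetter y})
    (t := (univ : Finset (Fin m × Bool))) <| card_le_two.trans_lt <| by
      rw [card_univ, Fintype.card_prod, Fintype.card_fin, Fintype.card_bool]
      lia
  obtain ⟨hxz, hxy⟩ : x ≠ z ∧ x ≠ invLetter y := by simpa using hx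
  refine ⟨x, hz x hxz, ?_⟩
  rw [← List.cons_append, List.getLast?_concat]
  simp only [Option.mem_some_iff, List.cons_append, List.head?_cons, forall_eq']
  exact fun h => ((ne_invLetter_iff x y).1 hxy h.symm).symm

theorem pow_le_card_B (hm : 2 ≤ m) (n : ℕ) : (2 * m - 1) ^ n ≤ #(B m (n + 1)) := by
  choose c hc using fun w : reducedWords m n =>
    exists_isCyclicallyReduced_cons hm (mem_reducedWords.1 w.2).2
  calc (2 * m - 1) ^ n
    _ ≤ Fintype.card (reducedWords m n) := by
        simpa using pow_le_card_reducedWords (by lia) n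
    _ ≤ #(B m (n + 1)) := by
        refine card_le_card_of_injOn (fun w => c w :: w.1) (fun w _ => ?_)
          fun v _ w _ h => Subtype.ext (List.cons.inj h).2
        exact mem_B.2 ⟨hc w, by simp [(mem_reducedWords.1 w.2).1]⟩

end ReducedWords

section CyclicSubwords

theorem card_le_two_mul_card_image_max {ι β : Type*} [LinearOrder β] {s : Finset ι} {f g : ι → β}
    (hf : Set.InjOn f s) (hg : Set.InjOn g s) : #s ≤ 2 * #(s.image fun j => max (f j) (g j)) := by
  classical
  refine card_le_mul_card_image s 2 fun p _ => ?_
  have hone : ∀ h : ι → β, Set.InjOn h s → #{j ∈ s | h j = p} ≤ 1 := fun h hh =>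
    card_le_one.2 fun a ha b hb => hh (mem_filter.1 ha).1 (mem_filter.1 hb).1
      ((mem_filter.1 ha).2.trans (mem_filter.1 hb).2.symm)
  calc #{j ∈ s | max (f j) (g j) = p}
    _ ≤ #({j ∈ s | f j = p} ∪ {j ∈ s | g j = p}) := by
        refine card_le_card fun j hj => ?_
        obtain ⟨hjs, rfl⟩ := mem_filter.1 hj
        rcases max_choice (f j) (g j) with h | h <;> simp [hjs, h]
    _ ≤ 1 + 1 := (card_union_le _ _).trans (add_le_add (hone f hf) (hone g hg))

/-- The position, in a word of length `n`, of the letter that gives rise to the letter number `j`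
of the cyclic subwords starting at position `i` of the word (if `ε = true`) or of its inverse. -/
def cyclicPos (n : ℕ) (ε : Bool) (i j : ℕ) : ℕ :=
  bif ε then (j + i) % n else n - 1 - (j + i) % n

theorem cyclicPos_lt {n : ℕ} (hn : 0 < n) (ε : Bool) (i j : ℕ) : cyclicPos n ε i j < n := by
  have := Nat.mod_lt (j + i) hn
  cases ε <;> simp only [cyclicPos, cond_true, cond_false] <;> lia

theorem mod_eq_of_cyclicPos_eq {n : ℕ} (hn : 0 < n) {ε : Bool} {i i' j j' : ℕ}
    (h : cyclicPos n ε i j = cyclicPos n ε i' j') : (j + i) % n = (j' + i') % n := by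
  have := Nat.mod_lt (j + i) hn
  have := Nat.mod_lt (j' + i') hn
  cases ε <;> simp only [cyclicPos, cond_true, cond_false] at h <;> lia

theorem cyclicPos_injOn {n L : ℕ} (hL : L ≤ n) (ε : Bool) (i : ℕ) :
    Set.InjOn (cyclicPos n ε i) (range L) := by
  intro j hj j' hj' h
  rw [mem_coe, mem_range] at hj hj'
  have hmod : j ≡ j' [MOD n] :=
    Nat.ModEq.add_right_cancel' i (mod_eq_of_cyclicPos_eq (by lia) h)
  exact hmod.eq_of_lt_of_lt (by lia) (by lia)

theorem cyclicPos_left_injective {n : ℕ} {ε : Bool} {i i' j : ℕ} (hi : i < n) (hi' : i' < n)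
    (h : cyclicPos n ε i j = cyclicPos n ε i' j) : i = i' := by
  have hmod : i ≡ i' [MOD n] :=
    Nat.ModEq.add_left_cancel' j (mod_eq_of_cyclicPos_eq (by lia) h)
  exact hmod.eq_of_lt_of_lt hi hi'

variable {m : ℕ}

/-- The letter `x` (if `ε = true`) or its formal inverse: the effect of `orient` on letters. -/
def orientLetter (ε : Bool) (x : Fin m × Bool) : Fin m × Bool :=
  bif ε then x else invLetter x

@[simp] theorem orientLetter_orientLetter (ε : Bool) (x : Fin m × Bool) :
    orientLetter ε (orientLetter ε x) = x := by
  cases ε <;> simp [orientLetter]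

theorem orientLetter_left_injective (x : Fin m × Bool) :
    Function.Injective fun ε => orientLetter ε x := by
  intro ε ε' h
  cases ε <;> cases ε' <;> simp_all [orientLetter, invLetter_ne, (invLetter_ne x).symm]

theorem length_orient (r : Word m) (ε : Bool) : (orient r ε).length = r.length := by
  cases ε <;> simp [orient]

theorem getElem?_rotate_orient (r : Word m) (ε : Bool) (i : ℕ) {j : ℕ} (hj : j < r.length) :
    ((orient r ε).rotate i)[j]? = (r[cyclicPos r.length ε i j]?).map (orientLetter ε) := by
  have hlt := Nat.mod_lt (j + i) (Nat.zero_lt_of_lt hj)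
  rw [List.getElem?_rotate (by rwa [length_orient]), length_orient]
  cases ε
  · simp only [orient, cyclicPos, cond_false, FreeGroup.invRev]
    rw [List.getElem?_reverse (by simpa using hlt), List.getElem?_map, List.length_map]
    rfl
  · have : (orientLetter true : Fin m × Bool → Fin m × Bool) = id := rfl
    simp [orient, cyclicPos, this]

variable {w w' r r' : Word m} {ε ε' : Bool} {i i' j n : ℕ}

theorem OccursAt.length_le (h : OccursAt w r ε i) : w.length ≤ r.length := by
  simpa [length_orient] using h.2.length_le

theorem OccursAt.getElem?_cyclicPos (h : OccursAt w r ε i) (hj : j < w.length) :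
    r[cyclicPos r.length ε i j]? = w[j]?.map (orientLetter ε) := by
  have hw : w[j]? = (r[cyclicPos r.length ε i j]?).map (orientLetter ε) := by
    rw [← getElem?_rotate_orient r ε i (hj.trans_le h.length_le)]
    obtain ⟨t, ht⟩ := h.2
    rw [← ht, List.getElem?_append_left hj]
  simp [hw, Function.comp_def]

theorem OccursAt.getElem?_cyclicPos_eq_iff (h : OccursAt w r ε i) (h' : OccursAt w' r' ε i)
    (hr : r.length = n) (hr' : r'.length = n) (hj : j < w.length) (hj' : j < w'.length) :
    r[cyclicPos n ε i j]? = r'[cyclicPos n ε i j]? ↔ w[j]? = w'[j]? := by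
  have hinv : Function.Involutive (orientLetter (m := m) ε) := orientLetter_orientLetter ε
  rw [show r[cyclicPos n ε i j]? = _ from hr ▸ h.getElem?_cyclicPos hj,
    show r'[cyclicPos n ε i j]? = _ from hr' ▸ h'.getElem?_cyclicPos hj',
    (Option.map_injective hinv.injective).eq_iff]

theorem OccursAt.take (h : OccursAt w r ε i) (L : ℕ) : OccursAt (w.take L) r ε i :=
  ⟨h.1, (w.take_prefix L).trans h.2⟩

theorem OccursAt.cyclicPos_ne (h : OccursAt w r ε i) (h' : OccursAt w r ε' i')
    (hne : (ε, i) ≠ (ε', i')) (hj : j < w.length) :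
    cyclicPos r.length ε i j ≠ cyclicPos r.length ε' i' j := fun hpos => by
  have hletter := (h.getElem?_cyclicPos hj).symm.trans (hpos ▸ h'.getElem?_cyclicPos hj)
  rw [List.getElem?_eq_getElem hj, Option.map_some, Option.map_some, Option.some_inj] at hletter
  obtain rfl := orientLetter_left_injective _ hletter
  exact hne (by rw [cyclicPos_left_injective h.1 h'.1 hpos])

/-- The words `r` and `r'`, or their inverses, have a common cyclic subword of length `L`, not
counting the coincidence of an occurrence with itself when `r = r'`. -/
def SharesPiece (L : ℕ) (r r' : Word m) : Prop :=
  ∃ w : Word m, w.length = L ∧ ∃ (ε ε' : Bool) (i i' : ℕ),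
    OccursAt w r ε i ∧ OccursAt w r' ε' i' ∧ (r, ε, i) ≠ (r', ε', i')

theorem exists_sharesPiece_of_not_smallCancellation {lam : ℝ} (hlam : 0 ≤ lam)
    {S : Set (Word m)} (h : ¬ SmallCancellation lam S) :
    ∃ r ∈ S, ∃ r' ∈ S, SharesPiece (⌊lam * r.length⌋₊ + 1) r r' := by
  simp only [SmallCancellation, not_forall, not_le] at h
  obtain ⟨w, ⟨r₁, h₁, r₂, h₂, ε₁, ε₂, i₁, i₂, o₁, o₂, hne⟩, r, hr, ⟨ε, i, o⟩, hw⟩ := h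
  have hL : ⌊lam * r.length⌋₊ + 1 ≤ w.length := (Nat.floor_lt (by positivity)).2 hw
  obtain ⟨r', hr', ε', i', o', hne'⟩ : ∃ r' ∈ S, ∃ ε' i', OccursAt w r' ε' i' ∧
      (r, ε, i) ≠ (r', ε', i') := by
    by_cases h : (r, ε, i) = (r₁, ε₁, i₁)
    · exact ⟨r₂, h₂, ε₂, i₂, o₂, h ▸ hne⟩
    · exact ⟨r₁, h₁, ε₁, i₁, o₁, h⟩
  exact ⟨r, hr, r', hr', w.take (⌊lam * r.length⌋₊ + 1), by simp [hL], ε, ε', i, i', o.take _,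
    o'.take _, hne'⟩

end CyclicSubwords

section CountingPieces

open Classical in
theorem card_filter_mul_le_card_mul {α ι : Type*} {s : Finset α} {I : Finset ι} {p : α → Prop}
    {Q : ι → α → Prop} {a c : ℕ} (hp : ∀ x ∈ s, p x → ∃ i ∈ I, Q i x)
    (hQ : ∀ i ∈ I, #{x ∈ s | Q i x} * a ≤ c) : #{x ∈ s | p x} * a ≤ #I * c := by
  have hsub : {x ∈ s | p x} ⊆ I.biUnion fun i => {x ∈ s | Q i x} := fun x hx => by
    obtain ⟨hxs, hpx⟩ := mem_filter.1 hx
    obtain ⟨i, hi, hix⟩ := hp x hxs hpx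
    exact mem_biUnion.2 ⟨i, hi, mem_filter.2 ⟨hxs, hix⟩⟩
  calc #{x ∈ s | p x} * a
    _ ≤ (∑ i ∈ I, #{x ∈ s | Q i x}) * a := by
        gcongr
        exact (card_le_card hsub).trans card_biUnion_le
    _ ≤ #I * c := by
        rw [sum_mul, ← smul_eq_mul #I, ← sum_const]
        exact sum_le_sum hQ

variable {m : ℕ}

open Classical in
theorem card_filter_occursAt_mul_pow_le (hm : 1 ≤ m) (w : Word m) (ε : Bool) (i n : ℕ) :
    #{r ∈ reducedWords m n | OccursAt w r ε i} * (2 * m - 1) ^ w.length ≤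
      2 * m * (2 * m - 1) ^ n := by
  rcases eq_empty_or_nonempty {r ∈ reducedWords m n | OccursAt w r ε i} with h0 | ⟨s, hs⟩
  · simp [h0]
  obtain ⟨hs, hocc⟩ := mem_filter.1 hs
  obtain ⟨rfl, -⟩ := mem_reducedWords.1 hs
  have hJ : #((range w.length).image (cyclicPos s.length ε i)) = w.length := by
    rw [card_image_of_injOn (cyclicPos_injOn hocc.length_le ε i), card_range]
  have h := card_filter_reducedWords_mul_pow_le hm (p := fun r => OccursAt w r ε i)
    (J := (range w.length).image (cyclicPos s.length ε i))
    (image_subset_iff.2 fun j _ => mem_range.2 (cyclicPos_lt (Nat.zero_lt_of_lt hocc.1) ε i j))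
    fun u hu v hv hou hov p hp _ => by
      obtain ⟨j, hj, rfl⟩ := mem_image.1 hp
      exact (hou.getElem?_cyclicPos_eq_iff hov (mem_reducedWords.1 hu).1 (mem_reducedWords.1 hv).1
        (mem_range.1 hj) (mem_range.1 hj)).2 rfl
  rwa [hJ] at h

/- Of the two positions at which a letter of the repeated subword occurs, the later one is
determined by the earlier one; each position is the later one of at most two such pairs. -/
open Classical in
theorem card_filter_occursAt_twice_mul_pow_le (hm : 1 ≤ m) (L n : ℕ) {ε ε' : Bool} {i i' : ℕ}
    (hne : (ε, i) ≠ (ε', i')) :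
    #{r ∈ reducedWords m n | ∃ w : Word m, w.length = L ∧ OccursAt w r ε i ∧ OccursAt w r ε' i'} *
      (2 * m - 1) ^ ((L + 1) / 2) ≤ 2 * m * (2 * m - 1) ^ n := by
  rcases eq_empty_or_nonempty {r ∈ reducedWords m n |
    ∃ w : Word m, w.length = L ∧ OccursAt w r ε i ∧ OccursAt w r ε' i'} with h0 | ⟨s, hs⟩
  · simp [h0]
  obtain ⟨hs, w, hw, hocc, -⟩ := mem_filter.1 hs
  have hsn := (mem_reducedWords.1 hs).1
  have hn : 0 < n := hsn ▸ Nat.zero_lt_of_lt hocc.1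
  have hLn : L ≤ n := hsn ▸ hw ▸ hocc.length_le
  let later : ℕ → ℕ := fun j => max (cyclicPos n ε i j) (cyclicPos n ε' i' j)
  have hJ : L ≤ 2 * #((range L).image later) := by
    simpa using card_le_two_mul_card_image_max (cyclicPos_injOn hLn ε i) (cyclicPos_injOn hLn ε' i')
  refine le_trans (Nat.mul_le_mul_left _ (Nat.pow_le_pow_right (by lia) (by lia))) <|
    card_filter_reducedWords_mul_pow_le hm (J := (range L).image later)
      (image_subset_iff.2 fun j _ => mem_range.2 (max_lt (cyclicPos_lt hn ..) (cyclicPos_lt hn ..)))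
      ?_
  rintro u hu v hv ⟨a, ha, hua, hua'⟩ ⟨b, hb, hvb, hvb'⟩ _ hp htake
  obtain ⟨j, hj, rfl⟩ := mem_image.1 hp
  obtain ⟨hun, -⟩ := mem_reducedWords.1 hu
  obtain ⟨hvn, -⟩ := mem_reducedWords.1 hv
  rw [mem_range] at hj
  have hja : j < a.length := ha ▸ hj
  have hjb : j < b.length := hb ▸ hj
  have hiff := hua.getElem?_cyclicPos_eq_iff hvb hun hvn hja hjb
  have hiff' := hua'.getElem?_cyclicPos_eq_iff hvb' hun hvn hja hjb
  have hbefore : ∀ x < later j, u[x]? = v[x]? := fun x hx => by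
    rw [← List.getElem?_take_of_lt hx, htake, List.getElem?_take_of_lt hx]
  rcases lt_or_gt_of_ne (hun ▸ hua.cyclicPos_ne hua' hne hja) with hlt | hlt
  · have hmax : later j = cyclicPos n ε' i' j := max_eq_right hlt.le
    exact hmax ▸ hiff'.2 (hiff.1 (hbefore _ (hmax ▸ hlt)))
  · have hmax : later j = cyclicPos n ε i j := max_eq_left hlt.le
    exact hmax ▸ hiff.2 (hiff'.1 (hbefore _ (hmax ▸ hlt)))

open Classical in
theorem card_filter_sharesPiece_mul_pow_le (hm : 1 ≤ m) (L n : ℕ) (r : Word m) :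
    #{r' ∈ reducedWords m n | SharesPiece L r r'} * (2 * m - 1) ^ L ≤
      4 * r.length * n * (2 * m) * (2 * m - 1) ^ n := by
  let I : Finset ((Bool × Bool) × ℕ × ℕ) := univ ×ˢ range r.length ×ˢ range n
  have hI : #I * (2 * m * (2 * m - 1) ^ n) = 4 * r.length * n * (2 * m) * (2 * m - 1) ^ n := by
    simp only [I, card_product, card_univ, Fintype.card_prod, Fintype.card_bool, card_range]
    ring
  rw [← hI]
  refine card_filter_mul_le_card_mul (Q := fun x r' => ∃ w : Word m, w.length = L ∧
    OccursAt w r x.1.1 x.2.1 ∧ OccursAt w r' x.1.2 x.2.2) ?_ ?_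
  · rintro r' hr' ⟨w, hw, ε, ε', i, i', h, h', -⟩
    have hi' : i' < n := (mem_reducedWords.1 hr').1 ▸ h'.1
    exact ⟨((ε, ε'), i, i'), by simp [I, h.1, hi'], w, hw, h, h'⟩
  · rintro ⟨⟨ε, ε'⟩, i, i'⟩ -
    by_cases hocc : ∃ w : Word m, w.length = L ∧ OccursAt w r ε i
    · obtain ⟨w, rfl, h⟩ := hocc
      refine le_trans ?_ (card_filter_occursAt_mul_pow_le hm w ε' i' n)
      gcongr with r'
      rintro ⟨v, hv, hvr, hvr'⟩
      have hvw : v = w := (List.prefix_of_prefix_length_le hvr.2 h.2 hv.le).eq_of_length hv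
      exact hvw ▸ hvr'
    · have hempty : ∀ r', ¬ ∃ w : Word m, w.length = L ∧ OccursAt w r ε i ∧ OccursAt w r' ε' i' :=
        fun _ ⟨w, hw, h, _⟩ => hocc ⟨w, hw, h⟩
      simp [hempty]

open Classical in
theorem card_filter_sharesPiece_self_mul_pow_le (hm : 1 ≤ m) (L n : ℕ) :
    #{r ∈ reducedWords m n | SharesPiece L r r} * (2 * m - 1) ^ ((L + 1) / 2) ≤
      4 * n * n * (2 * m) * (2 * m - 1) ^ n := by
  let I : Finset ((Bool × Bool) × ℕ × ℕ) := univ ×ˢ range n ×ˢ range n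
  have hI : #I * (2 * m * (2 * m - 1) ^ n) = 4 * n * n * (2 * m) * (2 * m - 1) ^ n := by
    simp only [I, card_product, card_univ, Fintype.card_prod, Fintype.card_bool, card_range]
    ring
  rw [← hI]
  refine card_filter_mul_le_card_mul (Q := fun x r => (x.1.1, x.2.1) ≠ (x.1.2, x.2.2) ∧
    ∃ w : Word m, w.length = L ∧ OccursAt w r x.1.1 x.2.1 ∧ OccursAt w r x.1.2 x.2.2) ?_ ?_
  · rintro r hr ⟨w, hw, ε, ε', i, i', h, h', hne⟩
    obtain ⟨rfl, -⟩ := mem_reducedWords.1 hr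
    exact ⟨((ε, ε'), i, i'), by simp [I, h.1, h'.1], by simpa using hne, w, hw, h, h'⟩
  · rintro ⟨⟨ε, ε'⟩, i, i'⟩ -
    by_cases hne : (ε, i) = (ε', i')
    · simp [hne]
    · simpa [hne] using card_filter_occursAt_twice_mul_pow_le hm L n hne

/-- The exponential growth rate of the number of reduced words in `m` letters and their
inverses. -/
noncomputable abbrev growthRate (m : ℕ) : ℝ :=
  (2 * m - 1 : ℕ)

theorem one_le_growthRate (hm : 1 ≤ m) : 1 ≤ growthRate m :=
  Nat.one_le_cast.2 (by lia)

theorem cast_le_mul_growthRate_rpow (hm : 1 ≤ m) {a b L n : ℕ} {x : ℝ}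
    (h : a * (2 * m - 1) ^ L ≤ b * (2 * m - 1) ^ n) (hx : n - L ≤ x) :
    (a : ℝ) ≤ b * growthRate m ^ x := by
  have hq := one_le_growthRate hm
  have hq0 : 0 < growthRate m := zero_lt_one.trans_le hq
  calc (a : ℝ)
    _ ≤ b * (growthRate m ^ n / growthRate m ^ L) := by
        rw [← mul_div_assoc, le_div_iff₀ (by positivity)]
        exact_mod_cast h
    _ = b * growthRate m ^ ((n : ℝ) - L) := by simp only [Real.rpow_sub hq0, Real.rpow_natCast]
    _ ≤ b * growthRate m ^ x := by gcongr

theorem sum_B_le {ℓ : ℕ} {f : Word m → ℝ} {C : ℝ} (hf : ∀ w, 0 ≤ f w)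
    (hC : ∀ n ≤ ℓ, ∑ w ∈ reducedWords m n, f w ≤ C) : ∑ w : B m ℓ, f w ≤ (ℓ + 1) * C := by
  have hsub : B m ℓ ⊆ (range (ℓ + 1)).biUnion (reducedWords m) := fun w hw =>
    mem_biUnion.2 ⟨_, mem_range.2 (Nat.lt_succ_of_le (mem_B.1 hw).2),
      mem_reducedWords.2 ⟨rfl, (mem_B.1 hw).1.1⟩⟩
  have hdisj : (range (ℓ + 1) : Set ℕ).PairwiseDisjoint (reducedWords m) :=
    fun i _ j _ hij => disjoint_left.2 fun w hi hj =>
      hij ((mem_reducedWords.1 hi).1.symm.trans (mem_reducedWords.1 hj).1)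
  calc ∑ w : B m ℓ, f w
    _ = ∑ w ∈ B m ℓ, f w := sum_coe_sort _ _
    _ ≤ ∑ n ∈ range (ℓ + 1), ∑ w ∈ reducedWords m n, f w := by
        rw [← sum_biUnion hdisj]
        exact sum_le_sum_of_subset_of_nonneg hsub fun w _ _ => hf w
    _ ≤ (ℓ + 1) * C := by
        refine (sum_le_card_nsmul _ _ _ fun n hn => hC n (by grind)).trans_eq ?_
        simp

variable {ℓ : ℕ} {lam : ℝ}

open Classical in
theorem card_filter_B_sharesPiece_le (hm : 1 ≤ m) (r : B m ℓ) :
    (#{r' : B m ℓ | SharesPiece (⌊lam * r.1.length⌋₊ + 1) r.1 r'.1} : ℝ) ≤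
      4 * (ℓ + 1) ^ 3 * (2 * m) * growthRate m ^ (ℓ - lam * r.1.length) := by
  have hr : (r.1.length : ℝ) ≤ ℓ := mod_cast (mem_B.1 r.2).2
  rw [natCast_card_filter]
  refine (sum_B_le (f := fun r' => if SharesPiece (⌊lam * r.1.length⌋₊ + 1) r.1 r' then 1 else 0)
    (C := 4 * (ℓ + 1) * (ℓ + 1) * (2 * m) * growthRate m ^ (ℓ - lam * r.1.length))
    (fun _ => by positivity) fun n hn => ?_).trans_eq (by ring)
  have hnℓ : (n : ℝ) ≤ ℓ := mod_cast hn
  have hexp : (n : ℝ) - (⌊lam * r.1.length⌋₊ + 1 : ℕ) ≤ ℓ - lam * r.1.length := by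
    push_cast
    linarith [Nat.lt_floor_add_one (lam * r.1.length)]
  rw [← natCast_card_filter]
  refine (cast_le_mul_growthRate_rpow hm
    (card_filter_sharesPiece_mul_pow_le hm _ n r.1) hexp).trans ?_
  push_cast
  gcongr <;> linarith

theorem sum_B_growthRate_rpow_le (hm : 1 ≤ m) (hlam : lam ≤ 1) :
    ∑ r : B m ℓ, growthRate m ^ (-lam * r.1.length) ≤
      (ℓ + 1) * (2 * m * growthRate m ^ ((1 - lam) * ℓ)) := by
  have hq := one_le_growthRate hm
  have hq0 : 0 < growthRate m := zero_lt_one.trans_le hq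
  refine sum_B_le (f := fun r => growthRate m ^ (-lam * r.length)) (fun _ => by positivity)
    fun n hn => ?_
  have hnℓ : (n : ℝ) ≤ ℓ := mod_cast hn
  calc ∑ r ∈ reducedWords m n, growthRate m ^ (-lam * r.length)
    _ = #(reducedWords m n) * growthRate m ^ (-lam * n) := by
        rw [← nsmul_eq_mul, ← sum_const]
        exact sum_congr rfl fun r hr => by rw [(mem_reducedWords.1 hr).1]
    _ ≤ 2 * m * growthRate m ^ n * growthRate m ^ (-lam * n) := by
        gcongr
        exact_mod_cast card_reducedWords_le hm n
    _ = 2 * m * growthRate m ^ ((1 - lam) * n) := by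
        rw [mul_assoc, ← Real.rpow_natCast, ← Real.rpow_add hq0]
        ring_nf
    _ ≤ 2 * m * growthRate m ^ ((1 - lam) * ℓ) := by
        gcongr

open Classical in
theorem card_filter_B_prod_sharesPiece_le (hm : 1 ≤ m) (hlam : lam ≤ 1) :
    (#{x ∈ (univ : Finset (B m ℓ)) ×ˢ (univ : Finset (B m ℓ)) |
      SharesPiece (⌊lam * x.1.1.length⌋₊ + 1) x.1.1 x.2.1} : ℝ) ≤
      4 * (2 * m) ^ 2 * ((ℓ + 1) ^ 4 * growthRate m ^ ((2 - lam) * ℓ)) := by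
  have hq0 : 0 < growthRate m := zero_lt_one.trans_le (one_le_growthRate hm)
  calc (#{x ∈ (univ : Finset (B m ℓ)) ×ˢ (univ : Finset (B m ℓ)) |
        SharesPiece (⌊lam * x.1.1.length⌋₊ + 1) x.1.1 x.2.1} : ℝ)
    _ = ∑ r : B m ℓ, (#{r' : B m ℓ | SharesPiece (⌊lam * r.1.length⌋₊ + 1) r.1 r'.1} : ℝ) := by
        simp only [natCast_card_filter, sum_product]
    _ ≤ ∑ r : B m ℓ, 4 * (ℓ + 1) ^ 3 * (2 * m) * growthRate m ^ (ℓ - lam * r.1.length) :=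
        sum_le_sum fun r _ => card_filter_B_sharesPiece_le hm r
    _ = 4 * (ℓ + 1) ^ 3 * (2 * m) * growthRate m ^ (ℓ : ℝ) *
          ∑ r : B m ℓ, growthRate m ^ (-lam * r.1.length) := by
        rw [mul_sum]
        refine sum_congr rfl fun r _ => ?_
        rw [mul_assoc _ (growthRate m ^ _), ← Real.rpow_add hq0, neg_mul, ← sub_eq_add_neg]
    _ ≤ 4 * (ℓ + 1) ^ 3 * (2 * m) * growthRate m ^ (ℓ : ℝ) *
          ((ℓ + 1) * (2 * m * growthRate m ^ ((1 - lam) * ℓ))) := by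
        gcongr
        exact sum_B_growthRate_rpow_le hm hlam
    _ = 4 * (2 * m) ^ 2 * ((ℓ + 1) ^ 4 * growthRate m ^ ((2 - lam) * ℓ)) := by
        rw [show (2 - lam) * ℓ = ℓ + (1 - lam) * ℓ by ring, Real.rpow_add hq0]
        ring

open Classical in
theorem card_filter_B_sharesPiece_self_le (hm : 1 ≤ m) (hlam : lam ≤ 2) :
    (#{r : B m ℓ | SharesPiece (⌊lam * r.1.length⌋₊ + 1) r.1 r.1} : ℝ) ≤
      4 * (2 * m) * ((ℓ + 1) ^ 3 * growthRate m ^ ((1 - lam / 2) * ℓ)) := by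
  have hq := one_le_growthRate hm
  rw [natCast_card_filter]
  refine (sum_B_le (f := fun r => if SharesPiece (⌊lam * r.length⌋₊ + 1) r r then 1 else 0)
    (C := 4 * (ℓ + 1) * (ℓ + 1) * (2 * m) * growthRate m ^ ((1 - lam / 2) * ℓ))
    (fun _ => by positivity) fun n hn => ?_).trans_eq (by ring)
  have hnℓ : (n : ℝ) ≤ ℓ := mod_cast hn
  set L := ⌊lam * n⌋₊ + 1
  have hL : lam * n < L := mod_cast Nat.lt_floor_add_one (lam * n)
  have hhalf : (L : ℝ) ≤ 2 * ((L + 1) / 2 : ℕ) := mod_cast (by lia : L ≤ 2 * ((L + 1) / 2))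
  have hexp : (n : ℝ) - ((L + 1) / 2 : ℕ) ≤ (1 - lam / 2) * ℓ := by
    calc (n : ℝ) - ((L + 1) / 2 : ℕ) ≤ (1 - lam / 2) * n := by linarith
      _ ≤ (1 - lam / 2) * ℓ := by gcongr; linarith
  rw [← natCast_card_filter, filter_congr (q := fun r => SharesPiece L r r) fun r hr => by
    rw [(mem_reducedWords.1 hr).1]]
  refine (cast_le_mul_growthRate_rpow hm
    (card_filter_sharesPiece_self_mul_pow_le hm L n) hexp).trans ?_
  push_cast
  gcongr <;> linarith

end CountingPieces

section SubsetsOfB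

variable {m ℓ L k : ℕ} {lam : ℝ}

theorem mem_relators {A : Finset (B m ℓ)} {r : Word m} :
    r ∈ relators A ↔ ∃ x ∈ A, x.1 = r := by
  simp only [relators, Set.mem_image, mem_coe]

open Classical in
theorem card_filter_not_smallCancellation_le (hm : 1 ≤ m) (hlam0 : 0 ≤ lam) (hlam1 : lam ≤ 1) :
    (#{A ∈ powersetCard k (univ : Finset (B m ℓ)) | ¬ SmallCancellation lam (relators A)} : ℝ) ≤
      (4 * (2 * m) ^ 2 * ((ℓ + 1) ^ 4 * growthRate m ^ ((2 - lam) * ℓ) * (k / #(B m ℓ)) ^ 2) +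
        4 * (2 * m) * ((ℓ + 1) ^ 3 * growthRate m ^ ((1 - lam / 2) * ℓ) * (k / #(B m ℓ)))) *
        (#(B m ℓ)).choose k := by
  calc (#{A ∈ powersetCard k (univ : Finset (B m ℓ)) | ¬ SmallCancellation lam (relators A)} : ℝ)
    _ ≤ #{A ∈ powersetCard k (univ : Finset (B m ℓ)) |
          ∃ r ∈ A, ∃ r' ∈ A, SharesPiece (⌊lam * r.1.length⌋₊ + 1) r.1 r'.1} := by
        gcongr with A
        intro hA
        obtain ⟨_, hr, _, hr', h⟩ := exists_sharesPiece_of_not_smallCancellation hlam0 hA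
        obtain ⟨x, hx, rfl⟩ := mem_relators.1 hr
        obtain ⟨x', hx', rfl⟩ := mem_relators.1 hr'
        exact ⟨x, hx, x', hx', h⟩
    _ ≤ _ := card_filter_powersetCard_exists_rel_le _ _ _
    _ ≤ (4 * (2 * m) ^ 2 * ((ℓ + 1) ^ 4 * growthRate m ^ ((2 - lam) * ℓ)) * (k / #(B m ℓ)) ^ 2 +
          4 * (2 * m) * ((ℓ + 1) ^ 3 * growthRate m ^ ((1 - lam / 2) * ℓ)) * (k / #(B m ℓ))) *
          (#(B m ℓ)).choose k := by
        rw [card_univ, Fintype.card_coe]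
        gcongr
        · exact card_filter_B_prod_sharesPiece_le hm hlam1
        · exact card_filter_B_sharesPiece_self_le hm (by linarith)
    _ = _ := by ring

theorem occursAt_take_of_le_length {r : Word m} (hL : 0 < L) (hr : L ≤ r.length) :
    OccursAt (r.take L) r true 0 :=
  ⟨hL.trans_le hr, by simpa [orient] using r.take_prefix L⟩

theorem injOn_take_of_smallCancellation (hlam : 0 ≤ lam) (hL : lam * ℓ < L) {A : Finset (B m ℓ)}
    (hA : SmallCancellation lam (relators A)) : Set.InjOn (fun x : B m ℓ => x.1.take L) A := by
  rintro ⟨r, hr⟩ hrA ⟨r', hr'⟩ hrA' (htake : r.take L = r'.take L)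
  by_contra hne
  have hne' : r ≠ r' := fun h => hne (Subtype.ext h)
  have hL0 : 0 < L := by
    have : (0 : ℝ) < L := lt_of_le_of_lt (by positivity) hL
    exact_mod_cast this
  have hmin : min L r.length = min L r'.length := by simpa using congrArg List.length htake
  have hLr : L ≤ r.length := by
    by_contra! hlt
    rw [List.take_of_length_le hlt.le, List.take_of_length_le (by lia)] at htake
    exact hne' htake
  have hocc := occursAt_take_of_le_length hL0 hLr
  have hocc' : OccursAt (r.take L) r' true 0 :=
    htake ▸ occursAt_take_of_le_length hL0 (by lia : L ≤ r'.length)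
  have hmem : r ∈ relators A := mem_relators.2 ⟨_, hrA, rfl⟩
  have hpiece : IsPiece (relators A) (r.take L) := ⟨r, hmem, r', mem_relators.2 ⟨_, hrA', rfl⟩,
    true, true, 0, 0, hocc, hocc', fun h => hne' (congrArg Prod.fst h)⟩
  have hle := hA _ hpiece r hmem ⟨true, 0, hocc⟩
  rw [List.length_take, min_eq_left hLr] at hle
  have hrℓ : (r.length : ℝ) ≤ ℓ := mod_cast (mem_B.1 hr).2
  nlinarith

theorem card_image_take_le (hm : 1 ≤ m) :
    #(univ.image fun x : B m ℓ => x.1.take L) ≤ (L + 1) * (2 * m * (2 * m - 1) ^ L) := by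
  have hsub : (univ.image fun x : B m ℓ => x.1.take L) ⊆
      (range (L + 1)).biUnion (reducedWords m) := image_subset_iff.2 fun x _ =>
    mem_biUnion.2 ⟨_, mem_range.2 (Nat.lt_succ_of_le (x.1.length_take_le L)), mem_reducedWords.2
      ⟨rfl, (mem_B.1 x.2).1.1.infix (x.1.take_prefix L).isInfix⟩⟩
  refine (card_le_card hsub).trans <| (card_biUnion_le_card_mul _ _ (2 * m * (2 * m - 1) ^ L)
    fun n hn => (card_reducedWords_le hm n).trans ?_).trans_eq (by rw [card_range])
  gcongr
  · lia
  · exact Nat.le_of_lt_succ (mem_range.1 hn)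

theorem card_image_take_floor_le (hm : 1 ≤ m) (hlam0 : 0 ≤ lam) (hlam1 : lam ≤ 1) :
    (#(univ.image fun x : B m ℓ => x.1.take (⌊lam * ℓ⌋₊ + 1)) : ℝ) ≤
      4 * m * growthRate m * ((ℓ + 1) * growthRate m ^ (lam * ℓ)) := by
  have hq := one_le_growthRate hm
  have hfloor : (⌊lam * ℓ⌋₊ : ℝ) ≤ lam * ℓ := Nat.floor_le (by positivity)
  have hfloor' : lam * ℓ ≤ ℓ := mul_le_of_le_one_left (by positivity) hlam1
  calc (#(univ.image fun x : B m ℓ => x.1.take (⌊lam * ℓ⌋₊ + 1)) : ℝ)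
    _ ≤ (⌊lam * ℓ⌋₊ + 1 + 1) * (2 * m * (growthRate m ^ (⌊lam * ℓ⌋₊ : ℝ) * growthRate m)) := by
        rw [Real.rpow_natCast, ← pow_succ]
        exact_mod_cast card_image_take_le hm
    _ ≤ (2 * (ℓ + 1)) * (2 * m * (growthRate m ^ (lam * ℓ) * growthRate m)) := by
        gcongr
        linarith
    _ = _ := by ring

open Classical in
theorem card_filter_smallCancellation_le (hlam : 0 ≤ lam) (hL : lam * ℓ < L)
    (hN : 0 < #(B m ℓ)) {y : ℝ} (hyN : y ≤ #(B m ℓ)) (hyk : y ≤ (k : ℝ) ^ 2)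
    (hy : 4 * #(univ.image fun x : B m ℓ => x.1.take L) ≤ y) :
    (#{A ∈ powersetCard k (univ : Finset (B m ℓ)) | SmallCancellation lam (relators A)} : ℝ) ≤
      8 * (#(univ.image fun x : B m ℓ => x.1.take L) / y) * (#(B m ℓ)).choose k := by
  have hcard : #(univ : Finset (B m ℓ)) = #(B m ℓ) := by rw [card_univ, Fintype.card_coe]
  have hM : (1 : ℝ) ≤ #(univ.image fun x : B m ℓ => x.1.take L) :=
    mod_cast ((card_pos.1 (hcard ▸ hN)).image _).card_pos
  have hMN : 2 * #(univ.image fun x : B m ℓ => x.1.take L) ≤ #(univ : Finset (B m ℓ)) := by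
    rw [hcard]
    exact_mod_cast (by linarith :
      2 * (#(univ.image fun x : B m ℓ => x.1.take L) : ℝ) ≤ #(B m ℓ))
  have hk : 2 ≤ k := by
    have : (2 : ℝ) ≤ k := le_of_sq_le_sq (by linarith) (Nat.cast_nonneg k)
    exact_mod_cast this
  calc (#{A ∈ powersetCard k (univ : Finset (B m ℓ)) | SmallCancellation lam (relators A)} : ℝ)
    _ ≤ #{A ∈ powersetCard k (univ : Finset (B m ℓ)) |
          #(A.image fun x => x.1.take L) = k} := by
        gcongr with A hA
        intro hC
        rw [card_image_of_injOn (injOn_take_of_smallCancellation hlam hL hC),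
          (mem_powersetCard.1 hA).2]
    _ ≤ 8 * #(univ.image fun x : B m ℓ => x.1.take L) / (k : ℝ) ^ 2 * (#(B m ℓ)).choose k :=
        hcard ▸ card_filter_powersetCard_card_image_eq_le _ _ _ hMN hk
    _ ≤ 8 * (#(univ.image fun x : B m ℓ => x.1.take L) / y) * (#(B m ℓ)).choose k := by
        rw [mul_div_assoc]
        gcongr
        linarith

end SubsetsOfB

section Asymptotics

theorem tendsto_succ_pow_mul_rpow {q s : ℝ} (hq : 1 < q) (hs : s < 0) (a : ℕ) :
    Tendsto (fun ℓ : ℕ => ((ℓ : ℝ) + 1) ^ a * q ^ (s * ℓ)) atTop (𝓝 0) := by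
  have hq0 : 0 < q := by linarith
  have hqs : 0 < q ^ s := Real.rpow_pos_of_pos hq0 s
  have hqs1 : |q ^ s| < 1 := by
    rw [abs_of_pos hqs]
    exact Real.rpow_lt_one_of_one_lt_of_neg hq hs
  have h := ((tendsto_pow_const_mul_const_pow_of_abs_lt_one a hqs1).comp
    (tendsto_add_atTop_nat 1)).mul_const (q ^ s)⁻¹
  rw [zero_mul] at h
  refine h.congr fun ℓ => ?_
  simp only [Function.comp_apply]
  rw [Real.rpow_mul hq0.le, Real.rpow_natCast, pow_succ]
  push_cast
  field_simp

variable {m : ℕ}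

theorem one_lt_growthRate (hm : 2 ≤ m) : 1 < growthRate m :=
  Nat.one_lt_cast.2 (by lia)

theorem card_B_rpow_le (hm : 2 ≤ m) {ℓ : ℕ} (hℓ : 1 ≤ ℓ) {s : ℝ} (hs : s ≤ 0) :
    (#(B m ℓ) : ℝ) ^ s ≤ growthRate m ^ (-s) * growthRate m ^ (s * ℓ) := by
  have hq0 : 0 < growthRate m := zero_lt_one.trans (one_lt_growthRate hm)
  obtain ⟨n, rfl⟩ := Nat.exists_eq_add_of_le' hℓ
  calc (#(B m (n + 1)) : ℝ) ^ s
    _ ≤ (growthRate m ^ n) ^ s := Real.rpow_le_rpow_of_nonpos (by positivity)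
        (mod_cast pow_le_card_B hm n) hs
    _ = growthRate m ^ (-s) * growthRate m ^ (s * (n + 1 : ℕ)) := by
        rw [← Real.rpow_natCast, ← Real.rpow_mul hq0.le, ← Real.rpow_add hq0]
        push_cast
        ring_nf

theorem tendsto_succ_pow_mul_rpow_mul_card_B_rpow (hm : 2 ≤ m) {u s : ℝ} (hs : s ≤ 0)
    (hus : u + s < 0) (a : ℕ) :
    Tendsto (fun ℓ : ℕ => ((ℓ : ℝ) + 1) ^ a * growthRate m ^ (u * ℓ) * (#(B m ℓ) : ℝ) ^ s)
      atTop (𝓝 0) := by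
  have hq := one_lt_growthRate hm
  have hq0 : 0 < growthRate m := zero_lt_one.trans hq
  have hlim := (tendsto_succ_pow_mul_rpow hq hus a).const_mul (growthRate m ^ (-s))
  rw [mul_zero] at hlim
  refine squeeze_zero' (.of_forall fun ℓ => by positivity) ?_ hlim
  filter_upwards [eventually_ge_atTop 1] with ℓ hℓ
  calc ((ℓ : ℝ) + 1) ^ a * growthRate m ^ (u * ℓ) * (#(B m ℓ) : ℝ) ^ s
    _ ≤ (ℓ + 1) ^ a * growthRate m ^ (u * ℓ) * (growthRate m ^ (-s) * growthRate m ^ (s * ℓ)) := by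
        gcongr
        exact card_B_rpow_le hm hℓ hs
    _ = growthRate m ^ (-s) * ((ℓ + 1) ^ a * growthRate m ^ ((u + s) * ℓ)) := by
        rw [add_mul, Real.rpow_add hq0]
        ring

theorem eventually_one_lt_card_B (hm : 2 ≤ m) : ∀ᶠ ℓ in atTop, 1 < #(B m ℓ) := by
  filter_upwards [eventually_ge_atTop 2] with ℓ hℓ
  obtain ⟨n, rfl⟩ := Nat.exists_eq_add_of_le' hℓ
  exact (Nat.one_lt_pow n.succ_ne_zero (by lia)).trans_le (pow_le_card_B hm (n + 1))

end Asymptotics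

section RandomGroups

variable {Ω : ℕ → Type*} [∀ ℓ, MeasurableSpace (Ω ℓ)] {P : ∀ ℓ, Measure (Ω ℓ)}
  [∀ ℓ, IsProbabilityMeasure (P ℓ)] {m : ℕ} {d : EReal} {lam : ℝ}
  {R : ∀ ℓ, Ω ℓ → Finset (B m ℓ)}

theorem aas_smallCancellation (hm : 2 ≤ m) (hlam0 : 0 ≤ lam) (hlam1 : lam ≤ 1)
    (hR : IsRandomGroupSequence P m d R) (hd : d < (lam / 2 : ℝ)) :
    AAS P fun ℓ ω => SmallCancellation lam (relators (R ℓ ω)) := by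
  classical
  obtain ⟨x, hdx, hx⟩ := EReal.lt_iff_exists_real_btwn.1 hd
  rw [EReal.coe_lt_coe_iff] at hx
  have hsize := hR.densable.aas_card_le_rpow (eventually_one_lt_card_B hm) hdx
  have hpairs := (tendsto_succ_pow_mul_rpow_mul_card_B_rpow hm (u := 2 - lam) (s := (x - 1) * 2)
    (by linarith) (by linarith) 4).const_mul (4 * (2 * m : ℝ) ^ 2)
  have hself := (tendsto_succ_pow_mul_rpow_mul_card_B_rpow hm (u := 1 - lam / 2) (s := x - 1)
    (by linarith) (by linarith) 3).const_mul (4 * (2 * m : ℝ))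
  have hε := hpairs.add hself
  rw [mul_zero, mul_zero, add_zero] at hε
  refine (aas_not_of_card_filter_le (K := fun ℓ => {k | (k : ℝ) ≤ (#(B m ℓ) : ℝ) ^ x})
    (F := fun ℓ A => ¬ SmallCancellation lam (relators A)) hR.randomSubset
    hR.permutationInvariant hsize hε ?_).mono_eventually (.of_forall fun _ _ => not_not.1)
  filter_upwards [eventually_one_lt_card_B hm] with ℓ hN k hk
  have hN0 : (0 : ℝ) < #(B m ℓ) := mod_cast zero_lt_one.trans hN
  have hkN : (k : ℝ) / #(B m ℓ) ≤ (#(B m ℓ) : ℝ) ^ (x - 1) := by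
    rw [Real.rpow_sub_one hN0.ne']
    gcongr
  have hkN' : ((k : ℝ) / #(B m ℓ)) ^ 2 ≤ (#(B m ℓ) : ℝ) ^ ((x - 1) * 2) := by
    rw [Real.rpow_mul hN0.le, Real.rpow_ofNat]
    gcongr
  refine (card_filter_not_smallCancellation_le (by lia) hlam0 hlam1).trans ?_
  gcongr

theorem aas_not_smallCancellation (hm : 2 ≤ m) (hlam0 : 0 ≤ lam) (hlam1 : lam < 1)
    (hR : IsRandomGroupSequence P m d R) (hd : (lam / 2 : ℝ) < d) :
    AAS P fun ℓ ω => ¬ SmallCancellation lam (relators (R ℓ ω)) := by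
  classical
  have hhalf : ((lam / 2 : ℝ) : EReal) < (1 / 2 : ℝ) := EReal.coe_lt_coe_iff.2 (by linarith)
  obtain ⟨x, hx, hxd⟩ := EReal.lt_iff_exists_real_btwn.1 (lt_min hd hhalf)
  obtain ⟨hxd, hx2⟩ := lt_min_iff.1 hxd
  rw [EReal.coe_lt_coe_iff] at hx hx2
  have hsize := hR.densable.aas_rpow_le_card (eventually_one_lt_card_B hm) hxd
  have hlim := (tendsto_succ_pow_mul_rpow_mul_card_B_rpow hm (u := lam) (s := -(x * 2))
    (by linarith) (by linarith) 1).const_mul (4 * m * growthRate m)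
  have hε := hlim.const_mul 8
  rw [mul_zero] at hlim
  rw [mul_zero, mul_zero] at hε
  refine aas_not_of_card_filter_le (K := fun ℓ => {k | (#(B m ℓ) : ℝ) ^ x ≤ k})
    (F := fun ℓ A => SmallCancellation lam (relators A)) hR.randomSubset
    hR.permutationInvariant hsize hε ?_
  filter_upwards [eventually_one_lt_card_B hm,
    hlim.eventually_le_const (show (0 : ℝ) < 1 / 4 by norm_num)] with ℓ hN hz k hk
  have hN1 : (1 : ℝ) ≤ #(B m ℓ) := mod_cast hN.le
  have hN0 : (0 : ℝ) < #(B m ℓ) := zero_lt_one.trans_le hN1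
  have hyN : (#(B m ℓ) : ℝ) ^ (x * 2) ≤ #(B m ℓ) :=
    Real.rpow_le_self_of_one_le hN1 (by linarith)
  have hyk : (#(B m ℓ) : ℝ) ^ (x * 2) ≤ (k : ℝ) ^ 2 := by
    rw [Real.rpow_mul hN0.le, Real.rpow_ofNat]
    gcongr
  have hM : #(univ.image fun r : B m ℓ => r.1.take (⌊lam * ℓ⌋₊ + 1)) /
      (#(B m ℓ) : ℝ) ^ (x * 2) ≤ 4 * m * growthRate m *
        ((ℓ + 1) ^ 1 * growthRate m ^ (lam * ℓ) * (#(B m ℓ) : ℝ) ^ (-(x * 2))) := by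
    rw [Real.rpow_neg hN0.le, ← div_eq_mul_inv, ← mul_div_assoc, pow_one]
    gcongr
    exact card_image_take_floor_le (by lia) hlam0 hlam1.le
  have hy := hM.trans hz
  rw [div_le_iff₀ (by positivity)] at hy
  refine (card_filter_smallCancellation_le hlam0 (mod_cast Nat.lt_floor_add_one _)
    (zero_lt_one.trans hN) hyN hyk (by linarith)).trans ?_
  gcongr

end RandomGroups

end RandomGroup

theorem mainTheorem4 {Ω : ℕ → Type*} [∀ ℓ, MeasurableSpace (Ω ℓ)]
    (P : ∀ ℓ, Measure (Ω ℓ)) [∀ ℓ, IsProbabilityMeasure (P ℓ)]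
    (m : ℕ) (hm : 2 ≤ m) (d : EReal) (lam : ℝ) (hlam0 : 0 < lam) (hlam1 : lam < 1)
    (R : ∀ ℓ, Ω ℓ → Finset (RandomGroup.B m ℓ))
    (hR : RandomGroup.IsRandomGroupSequence P m d R) :
    (d < ((lam / 2 : ℝ) : EReal) →
      RandomGroup.AAS P fun ℓ ω =>
        RandomGroup.SmallCancellation lam (RandomGroup.relators (R ℓ ω))) ∧
    (((lam / 2 : ℝ) : EReal) < d →
      RandomGroup.AAS P fun ℓ ω =>
        ¬ RandomGroup.SmallCancellation lam (RandomGroup.relators (R ℓ ω))) :=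
  ⟨RandomGroup.aas_smallCancellation hm hlam0.le hlam1.le hR,
    RandomGroup.aas_not_smallCancellation hm hlam0.le hlam1 hR⟩
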